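/- Let $G$ be a finite connected $4$-regular graph (loops and multiple edges allowed) with edge set $E$. Orient its edges, and write $+e$ and $-e$ for the incoming and the outgoing end of the edge $e$, so that $G$ has the set $D=\{\pm e: e\in E\}$ of edge ends and exactly four of them lie at each vertex. Let a cyclic ordering at the vertices be given, i.e. for each vertex $v$ an ordering $(e_v^0,e_v^1,e_v^2,e_v^3)$ of the four edge ends at $v$, with upper indices read modulo $4$. Define the successor map $s:D\to D$ by $s(e_v^j)=-e_v^{j+1}$; it is a permutation of $D$. For each orbit of $s$, of length $n$ say, take a polygon with $n$ sides (a closed disk in the plane whose boundary circle is divided into $n$ arcs; $n=1,2$ are allowed) and label its sides clockwise with the elements $d,s(d),\dots,s^{n-1}(d)$ of the orbit. For every edge $e$ glue the side labelled $+e$ to the side labelled $-e$, so that the side $+e$ traversed clockwise is identified with the side $-e$ traversed counterclockwise. Then the resulting cell complex (the quotient space of the disjoint union of the polygons) is homeomorphic to a closed, connected, orientable surface, i.e. to a compact, connected, smooth $2$-manifold without boundary (Hausdorff and second countable) that has an atlas of charts of its smooth structure whose coordinate changes all have positive Jacobian determinant. -/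

import Mathlib

open scoped Manifold ContDiff

universe u

/-- A graph with loops and multiple edges allowed, vertex set `V`, edge set `E`, and oriented edges.
Every edge `e` has two ends, the incoming (positive) end `(e, 1)` and the outgoing (negative) end
`(e, -1)`; `inc` sends an edge end to the vertex at which it sits. The edge `e` is oriented
from `inc (e, -1)` to `inc (e, 1)`. -/
structure OrientedMultigraph (V E : Type*) where
  inc : E × ℤˣ → V

namespace OrientedMultigraph

variable {V E : Type*}

/-- Every vertex carries exactly `k` edge ends (a loop contributes two). -/
def IsRegularOfDegree (G : OrientedMultigraph V E) (k : ℕ) : Prop :=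
  ∀ v : V, Nat.card {d : E × ℤˣ // G.inc d = v} = k

/-- Connectedness of the underlying graph; this includes that there is at least one vertex. -/
def Connected (G : OrientedMultigraph V E) : Prop :=
  (SimpleGraph.fromRel fun v w : V => ∃ e : E, G.inc (e, -1) = v ∧ G.inc (e, 1) = w).Connected

/-- An ordering `(e_v^0, e_v^1, e_v^2, e_v^3)` of the four edge ends at each vertex `v`,
with indices read modulo `4`. -/
structure CyclicOrdering (G : OrientedMultigraph V E) where
  order : ∀ v : V, ZMod 4 ≃ {d : E × ℤˣ // G.inc d = v}

/-- The sign change `±e ↦ ∓e` on signed edge labels. -/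
def opp : Equiv.Perm (E × ℤˣ) := Equiv.prodCongr (Equiv.refl E) (Equiv.neg ℤˣ)

namespace CyclicOrdering

variable {G : OrientedMultigraph V E} (c : G.CyclicOrdering)

/-- The permutation `e_v^j ↦ e_v^{j+1}` of the edge ends. -/
def rot : Equiv.Perm (E × ℤˣ) :=
  (Equiv.sigmaFiberEquiv G.inc).permCongr
    (Equiv.Perm.sigmaCongrRight fun v => (c.order v).permCongr (Equiv.addRight 1))

/-- The successor map `e_v^j ↦ -e_v^{j+1}`. -/
def succ : Equiv.Perm (E × ℤˣ) := c.rot.trans opp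

theorem rot_order (v : V) (j : ZMod 4) :
    c.rot (c.order v j : E × ℤˣ) = (c.order v (j + 1) : E × ℤˣ) := by
  have h : (Equiv.sigmaFiberEquiv G.inc).symm (c.order v j : E × ℤˣ) = ⟨v, c.order v j⟩ := by
    rw [Equiv.symm_apply_eq]; rfl
  rw [rot, Equiv.permCongr_apply, h]
  simp [Equiv.Perm.sigmaCongrRight, Equiv.permCongr_apply, Equiv.sigmaFiberEquiv]

theorem succ_order (v : V) (j : ZMod 4) :
    c.succ (c.order v j : E × ℤˣ) =
      ((c.order v (j + 1) : E × ℤˣ).1, -(c.order v (j + 1) : E × ℤˣ).2) := by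
  simp only [succ, Equiv.trans_apply, rot_order]
  rfl

/-- The orbits of the successor map. -/
def Face : Type _ := Quotient (Equiv.Perm.SameCycle.setoid c.succ)

/-- A chosen label in each orbit; it labels side number `0` of the polygon of that orbit. -/
noncomputable def base (f : c.Face) : E × ℤˣ := Quotient.out f

/-- The number of sides of the polygon of `f`, which is the length of the orbit `f`. -/
noncomputable def numSides (f : c.Face) : ℕ := Function.minimalPeriod c.succ (c.base f)

/-- The disjoint union of the polygons, one for each orbit. A polygon with `n` sides (`n = 1` and
`n = 2` do occur) is the closed unit disk in the plane, with its boundary circle cut into `n`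
equal arcs. -/
def Polygons : Type _ := (_ : c.Face) × Metric.closedBall (0 : ℂ) 1

noncomputable instance : TopologicalSpace c.Polygons :=
  inferInstanceAs (TopologicalSpace ((_ : c.Face) × Metric.closedBall (0 : ℂ) 1))

/-- The boundary point of the polygon `f` reached from its initial corner by walking clockwise
along `x` sides. For `k : ℕ`, the numbers `x ∈ [k, k + 1]` sweep out side number `k`, which
carries the label `succ^k (base f)`. -/
noncomputable def bdry (f : c.Face) (x : ℝ) : c.Polygons :=
  ⟨f, ⟨Complex.exp (((-(2 * Real.pi * x / c.numSides f) : ℝ) : ℂ) * Complex.I), by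
    rw [mem_closedBall_zero_iff, Complex.norm_exp_ofReal_mul_I]⟩⟩

/-- The side identification: the two sides labelled `+e` and `-e` are glued along the edge `e`.
Walking clockwise, a side labelled `+e` is traversed with the orientation of `e` and a side
labelled `-e` against it, so the gluing reverses the clockwise parameter. -/
inductive Glue : c.Polygons → c.Polygons → Prop
  | side (f g : c.Face) (k l : ℕ) (t : ℝ) (ht : t ∈ Set.Icc (0 : ℝ) 1)
      (h : (c.succ ^ l) (c.base g) = opp ((c.succ ^ k) (c.base f))) :
      Glue (c.bdry f (k + t)) (c.bdry g (l + (1 - t)))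

/-- The associated cell complex: the quotient space of the polygons by the equivalence relation
generated by the side identifications. -/
def CellComplex : Type _ := Quot c.Glue

noncomputable instance : TopologicalSpace c.CellComplex :=
  inferInstanceAs (TopologicalSpace (Quot c.Glue))

end CyclicOrdering

end OrientedMultigraph

/-- A smooth surface is orientable if it is covered by charts of its smooth structure all of whose
coordinate changes have positive Jacobian determinant. -/
def IsOrientableSurface (S : Type*) [TopologicalSpace S]
    [ChartedSpace (EuclideanSpace ℝ (Fin 2)) S] : Prop :=
  ∃ A : Set (OpenPartialHomeomorph S (EuclideanSpace ℝ (Fin 2))),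
    A ⊆ IsManifold.maximalAtlas (𝓡 2) ∞ S ∧
    (∀ p : S, ∃ φ ∈ A, p ∈ φ.source) ∧
    ∀ φ ∈ A, ∀ ψ ∈ A, ∀ x ∈ (φ.symm.trans ψ).source,
      0 < (fderiv ℝ (φ.symm.trans ψ) x).det

/-!
The proof makes the cell complex a Riemann surface, by charts whose coordinate changes are given by
explicit holomorphic functions with nonvanishing derivative. Regarded as a real linear map, such a
derivative has positive determinant, so the complex charts are at the same time an oriented smooth
atlas (`exists_orientable_surface_of_conformallyRelated`).

The punctured disk of a polygon with `n` sides is covered by the closed lower half-plane, by means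
of `w ↦ exp (-2πi w / n)`; side number `k` becomes the interval `[k, k + 1]`. In the coordinate
`side d w`, shifted such that the side labelled `d` is `[0, 1]`, the successor map is `w ↦ w + 1`
and the gluing of the sides `d` and `opp d` is `t ↦ 1 - t`. This extends to the half-turn
`w ↦ 1 - w`, which exchanges the two half-planes. Therefore the coordinates of the two polygons at
an edge fit together to a parametrization by the strip `0 < re w < 1` (`edgeParam`). At the start of
the side `d`, the corners are permuted by `turn`, which corresponds to `w ↦ -w`. As four edge ends
lie at a vertex of the graph, `turn` has order four with orbits of length four, and
`G.inc (opp d)` separates these orbits: the vertices of the complex are the vertices of the graph,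
and at each of them exactly four half-planes meet. Four half-planes make up two full turns, which
the substitution `w = ± ζ ^ 2` unwinds to the four quadrants of one plane (`vertexParam`). Together
with the interiors of the polygons these are all the charts.

All coordinate changes and the local properties of the parametrizations reduce to three standard
types of points (`IsStandard`): interior points of polygons, interior points of edges, and vertices.
The reason is that `ConformallyRelated` is an equivalence relation which every point of every
parametrization bears to a standard one (`exists_standard`), and it preserves values and images of
neighbourhood filters (`map_param_le`, `related_of_param_eq`). At the standard points one has to
know which points of the polygons are identified (`eq_of_toCell_eq`, `toCell_eq_side_iff`,
`exists_turn_pow_of_toCell_eq`).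

The Hausdorff property follows from the injective open parametrizations and two continuous functions
which respect the gluing and separate the three types of points: `‖z‖` and the real part of `z ^ n`.
Compactness is inherited from the finitely many polygons. For connectedness, a continuous function
to a discrete space is constant on each polygon, so that it induces a function of labels which is
invariant under `succ`, `opp` and `rot`, and therefore constant along walks in the connected graph.
-/

open Filter Set
open scoped Topology

/-! ### Surfaces from conformally compatible parametrizations -/

section ConformalParametrizations

variable {X ι : Type*}

/-- For a family `Φ` of parametrizations of `X` by parts of the plane: near `z`, the parametrization
`Φ i` is `Φ j` after a holomorphic change of coordinates `g` with `g z = w` and `g' z ≠ 0`. -/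
def ConformallyRelated (Φ : ι → ℂ → X) (i : ι) (z : ℂ) (j : ι) (w : ℂ) : Prop :=
  ∃ g : ℂ → ℂ, AnalyticAt ℂ g z ∧ deriv g z ≠ 0 ∧ g z = w ∧ ∀ᶠ u in 𝓝 z, Φ i u = Φ j (g u)

namespace ConformallyRelated

variable {Φ : ι → ℂ → X} {i j k : ι} {z w x : ℂ}

theorem refl (Φ : ι → ℂ → X) (i : ι) (z : ℂ) : ConformallyRelated Φ i z i z :=
  ⟨id, analyticAt_id, by simp, rfl, by simp⟩

theorem symm (h : ConformallyRelated Φ i z j w) : ConformallyRelated Φ j w i z := by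
  obtain ⟨g, hg, hg', rfl, hΦ⟩ := h
  have hs := hg.hasStrictDerivAt
  have hinv : HasStrictDerivAt.localInverse g _ z hs hg' (g z) = z :=
    HasStrictFDerivAt.localInverse_apply_image ..
  have ha := hg.analyticAt_localInverse hg'
  refine ⟨_, ha, ?_, hinv, ?_⟩
  · rw [(hs.to_localInverse hg').hasDerivAt.deriv]
    exact inv_ne_zero hg'
  · have hc := ha.continuousAt
    rw [ContinuousAt, hinv] at hc
    filter_upwards [hc.eventually hΦ, hs.eventually_right_inverse hg'] with u hu hu'
    rw [hu, hu']

theorem trans (h : ConformallyRelated Φ i z j w) (h' : ConformallyRelated Φ j w k x) :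
    ConformallyRelated Φ i z k x := by
  obtain ⟨g, hg, hg', rfl, hΦ⟩ := h
  obtain ⟨f, hf, hf', rfl, hΦ'⟩ := h'
  refine ⟨f ∘ g, hf.comp hg, ?_, rfl, ?_⟩
  · rw [deriv_comp _ hf.differentiableAt hg.differentiableAt]
    exact mul_ne_zero hf' hg'
  · filter_upwards [hΦ, hg.continuousAt.eventually hΦ'] with u hu hu'
    rw [hu, hu', Function.comp_apply]

theorem apply_eq (h : ConformallyRelated Φ i z j w) : Φ i z = Φ j w := by
  obtain ⟨g, -, -, rfl, hΦ⟩ := h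
  exact hΦ.self_of_nhds

theorem map_nhds_eq (h : ConformallyRelated Φ i z j w) : map (Φ i) (𝓝 z) = map (Φ j) (𝓝 w) := by
  obtain ⟨g, hg, hg', rfl, hΦ⟩ := h
  rw [map_congr hΦ, ← hg.hasStrictDerivAt.map_nhds_eq hg', map_map]
  rfl

end ConformallyRelated

/-- As a real linear map of the plane, multiplication by `a ≠ 0` preserves the orientation. -/
theorem det_fderiv_conj_pos {E : Type*} [NormedAddCommGroup E] [NormedSpace ℝ E]
    (L : ℂ ≃L[ℝ] E) {g : ℂ → ℂ} {x : E} (hg : DifferentiableAt ℂ g (L.symm x))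
    (hg' : deriv g (L.symm x) ≠ 0) : 0 < (fderiv ℝ (fun y => L (g (L.symm y))) x).det := by
  have h1 : HasFDerivAt g
      ((ContinuousLinearMap.toSpanSingleton ℂ (deriv g (L.symm x))).restrictScalars ℝ)
      (L.symm x) := hg.hasDerivAt.hasFDerivAt.restrictScalars ℝ
  have h2 := L.hasFDerivAt.comp x (h1.comp x L.symm.hasFDerivAt)
  rw [show (fun y => L (g (L.symm y))) = L ∘ g ∘ L.symm from rfl, h2.fderiv]
  have h3 := LinearMap.det_conj ((ContinuousLinearMap.toSpanSingleton ℂ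
    (deriv g (L.symm x))).restrictScalars ℝ : ℂ →ₗ[ℝ] ℂ) L.toLinearEquiv
  have h4 : LinearMap.det ((ContinuousLinearMap.toSpanSingleton ℂ
      (deriv g (L.symm x))).restrictScalars ℝ : ℂ →ₗ[ℝ] ℂ) =
        Complex.normSq (deriv g (L.symm x)) := by
    rw [← Algebra.norm_complex_apply, Algebra.norm_apply]
    congr 1
    ext u
    simp [mul_comm]
  refine lt_of_lt_of_eq (Complex.normSq_pos.2 hg') (h4.symm.trans (h3.symm.trans ?_))
  rfl

/-- A space covered by injective open parametrizations which are conformally compatible is an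
oriented smooth surface. -/
theorem exists_orientable_surface_of_conformallyRelated [TopologicalSpace X]
    (Φ : ι → ℂ → X) (U : ι → Set ℂ) (hU : ∀ i, IsOpen (U i))
    (hc : ∀ i, ContinuousOn (Φ i) (U i)) (hinj : ∀ i, InjOn (Φ i) (U i))
    (hopen : ∀ i, ∀ W ⊆ U i, IsOpen W → IsOpen (Φ i '' W))
    (hcover : ∀ p, ∃ i, ∃ z ∈ U i, Φ i z = p)
    (hrel : ∀ i j, ∀ z ∈ U i, ∀ w ∈ U j, Φ i z = Φ j w → ConformallyRelated Φ i z j w) :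
    ∃ _ : ChartedSpace (EuclideanSpace ℝ (Fin 2)) X,
      IsManifold (𝓡 2) ∞ X ∧ IsOrientableSurface X := by
  let L : ℂ ≃L[ℝ] EuclideanSpace ℝ (Fin 2) :=
    Complex.orthonormalBasisOneI.repr.toContinuousLinearEquiv
  have hmap : ∀ i, IsOpenMap ((U i).domRestrict (Φ i)) := by
    intro i W hW
    have h := hopen i (Subtype.val '' W) (by rintro _ ⟨x, -, rfl⟩; exact x.2)
      ((hU i).isOpenMap_subtype_val W hW)
    rwa [image_image] at h
  let e : ι → OpenPartialHomeomorph ℂ X := fun i =>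
    .ofContinuousOpenRestrict ((hinj i).toPartialEquiv (Φ i) (U i)) (hc i) (hmap i) (hU i)
  let φ : ι → OpenPartialHomeomorph X (EuclideanSpace ℝ (Fin 2)) := fun i =>
    (e i).symm.trans L.toHomeomorph.toOpenPartialHomeomorph
  have hleft : ∀ i, ∀ z ∈ U i, (e i).symm (Φ i z) = z := fun i z hz => (e i).left_inv hz
  have hsource : ∀ i, ∀ z ∈ U i, Φ i z ∈ (φ i).source := by
    intro i z hz
    have h : Φ i z ∈ (e i).target := (e i).map_source hz
    simpa [φ] using h
  have key : ∀ i j, ∀ x ∈ ((φ i).symm.trans (φ j)).source, ∃ g : ℂ → ℂ,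
      AnalyticAt ℂ g (L.symm x) ∧ deriv g (L.symm x) ≠ 0 ∧
      ((φ i).symm.trans (φ j)) =ᶠ[𝓝 x] fun y => L (g (L.symm y)) := by
    intro i j x hx
    have hx1 : L.symm x ∈ U i := by
      have h : L.symm x ∈ (e i).source := by simpa [φ] using hx.1
      exact h
    have hx2 : Φ i (L.symm x) ∈ (e j).target := by
      have h : e i (L.symm x) ∈ (e j).target := by simpa [φ] using hx.2
      exact h
    have hw : (e j).symm (Φ i (L.symm x)) ∈ U j := (e j).map_target hx2
    obtain ⟨g, hg, hg', hgz, hΦ⟩ := hrel i j _ hx1 _ hw ((e j).right_inv hx2).symm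
    refine ⟨g, hg, hg', ?_⟩
    have hev : ∀ᶠ u in 𝓝 (L.symm x), g u ∈ U j :=
      hg.continuousAt.eventually_mem ((hU j).mem_nhds (hgz ▸ hw))
    filter_upwards [L.symm.continuous.continuousAt.eventually (hΦ.and hev)] with y hy
    change L ((e j).symm (Φ i (L.symm y))) = L (g (L.symm y))
    rw [hy.1, hleft j _ hy.2]
  choose ind hind using hcover
  let C : ChartedSpace (EuclideanSpace ℝ (Fin 2)) X :=
    { atlas := range φ
      chartAt := fun p => φ (ind p)
      mem_chart_source := fun p => by
        obtain ⟨z, hz, hp⟩ := hind p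
        have := hsource _ z hz
        rwa [hp] at this
      chart_mem_atlas := fun p => ⟨_, rfl⟩ }
  have hman : IsManifold (𝓡 2) ∞ X := by
    apply isManifold_of_contDiffOn
    rintro _ _ ⟨i, rfl⟩ ⟨j, rfl⟩ x hx
    obtain ⟨g, hg, -, hev⟩ := key i j x hx.1
    have hsm : ContDiffAt ℝ ∞ (fun y => L (g (L.symm y))) x :=
      L.contDiff.contDiffAt.comp x
        ((hg.contDiffAt.restrict_scalars ℝ).comp x L.symm.contDiff.contDiffAt)
    exact (hsm.congr_of_eventuallyEq hev).contDiffWithinAt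
  refine ⟨C, hman, range φ, IsManifold.subset_maximalAtlas, fun p => ?_, ?_⟩
  · exact ⟨_, ⟨ind p, rfl⟩, mem_chart_source _ p⟩
  · rintro _ ⟨i, rfl⟩ _ ⟨j, rfl⟩ x hx
    obtain ⟨g, hg, hg', hev⟩ := key i j x hx
    rw [hev.fderiv_eq]
    exact det_fderiv_conj_pos L hg.differentiableAt hg'

end ConformalParametrizations

namespace OrientedMultigraph

variable {V E : Type*}

/-! ### The combinatorics of labels, faces and corners -/

theorem opp_opp (d : E × ℤˣ) : opp (opp d) = d :=
  Prod.ext rfl (neg_neg d.2)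

theorem opp_ne (d : E × ℤˣ) : opp d ≠ d := by
  intro h
  have h2 : -d.2 = d.2 := congrArg Prod.snd h
  rcases Int.units_eq_one_or d.2 with h1 | h1 <;> rw [h1] at h2 <;> revert h2 <;> decide

namespace CyclicOrdering

variable {G : OrientedMultigraph V E} (c : G.CyclicOrdering)

theorem opp_succ (d : E × ℤˣ) : opp (c.succ d) = c.rot d :=
  opp_opp _

/-- Turning to the next corner at a vertex of the cell complex: of the two sides of a polygon which
meet at the initial corner of `d`, the other one is `succ⁻¹ d`, and the side glued to it, namely
`turn d`, starts at the same vertex as `d`. -/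
def turn : Equiv.Perm (E × ℤˣ) := c.succ.symm.trans opp

theorem turn_succ (d : E × ℤˣ) : c.turn (c.succ d) = opp d := by
  simp [turn]

theorem rot_pow_order (v : V) (j : ZMod 4) (m : ℕ) :
    (c.rot ^ m) (c.order v j : E × ℤˣ) = c.order v (j + m) := by
  induction m with
  | zero => simp
  | succ m ih =>
    rw [pow_succ', Equiv.Perm.mul_apply, ih, rot_order]
    push_cast
    rw [add_assoc]

theorem exists_order_eq (d : E × ℤˣ) : ∃ j, (c.order (G.inc d) j : E × ℤˣ) = d := by
  refine ⟨(c.order (G.inc d)).symm ⟨d, rfl⟩, ?_⟩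
  simp

theorem inc_rot (d : E × ℤˣ) : G.inc (c.rot d) = G.inc d := by
  obtain ⟨j, hj⟩ := c.exists_order_eq d
  have h := c.rot_order (G.inc d) j
  rw [hj] at h
  rw [h]
  exact (c.order (G.inc d) (j + 1)).2

theorem rot_pow_four (d : E × ℤˣ) : (c.rot ^ 4) d = d := by
  obtain ⟨j, hj⟩ := c.exists_order_eq d
  have h := c.rot_pow_order (G.inc d) j 4
  rw [hj] at h
  rw [h]
  have : ((4 : ℕ) : ZMod 4) = 0 := by decide
  rw [this, add_zero, hj]

theorem rot_pow_injective (d : E × ℤˣ) {m n : ℕ} (hm : m < 4) (hn : n < 4)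
    (h : (c.rot ^ m) d = (c.rot ^ n) d) : m = n := by
  obtain ⟨j, hj⟩ := c.exists_order_eq d
  rw [← hj, rot_pow_order, rot_pow_order, Subtype.coe_inj, (c.order _).apply_eq_iff_eq,
    add_right_inj] at h
  interval_cases m <;> interval_cases n <;> first | rfl | (revert h; decide)

theorem exists_rot_pow_eq {d d' : E × ℤˣ} (h : G.inc d = G.inc d') :
    ∃ m : ℕ, (c.rot ^ m) d = d' := by
  obtain ⟨j, hj⟩ := c.exists_order_eq d
  obtain ⟨j', hj'⟩ := c.exists_order_eq d'
  rw [← h] at hj'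
  refine ⟨(j' - j).val, ?_⟩
  conv_lhs => rw [← hj]
  rw [rot_pow_order, ← hj']
  simp

theorem rot_opp_turn (d : E × ℤˣ) : c.rot (opp (c.turn d)) = opp d := by
  rw [← opp_succ, turn, Equiv.trans_apply, opp_opp, Equiv.apply_symm_apply]

theorem rot_pow_opp_turn_pow (d : E × ℤˣ) (m : ℕ) :
    (c.rot ^ m) (opp ((c.turn ^ m) d)) = opp d := by
  induction m with
  | zero => simp
  | succ m ih =>
    rw [pow_succ, pow_succ', Equiv.Perm.mul_apply, Equiv.Perm.mul_apply, rot_opp_turn, ih]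

theorem turn_pow_four (d : E × ℤˣ) : (c.turn ^ 4) d = d := by
  have h := c.rot_pow_opp_turn_pow d 4
  rwa [rot_pow_four, opp.injective.eq_iff] at h

/-- Four distinct corners meet at each vertex of the cell complex. -/
theorem turn_pow_injective (d : E × ℤˣ) {m n : ℕ} (hm : m < 4) (hn : n < 4)
    (h : (c.turn ^ m) d = (c.turn ^ n) d) : m = n := by
  have h1 := c.rot_pow_opp_turn_pow d m
  have h2 := c.rot_pow_opp_turn_pow d n
  rw [h] at h1
  exact c.rot_pow_injective _ hm hn (h1.trans h2.symm)

theorem turn_pow_mod_four (d : E × ℤˣ) (m : ℕ) : (c.turn ^ (m % 4)) d = (c.turn ^ m) d := by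
  have h : c.turn ^ 4 = 1 := Equiv.ext c.turn_pow_four
  conv_rhs => rw [← Nat.div_add_mod m 4, pow_add, pow_mul, h, one_pow, one_mul]

theorem mod_four_eq_zero_of_turn_pow_eq_self {d : E × ℤˣ} {m : ℕ} (h : (c.turn ^ m) d = d) :
    m % 4 = 0 := by
  refine c.turn_pow_injective d (Nat.mod_lt _ (by norm_num)) (by norm_num) ?_
  rw [turn_pow_mod_four, h, pow_zero, Equiv.Perm.one_apply]

/-- The corners at a vertex of the cell complex are permuted transitively by `turn`. -/
theorem exists_turn_pow_eq {d d' : E × ℤˣ} (h : G.inc (opp d) = G.inc (opp d')) :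
    ∃ m : ℕ, (c.turn ^ m) d = d' := by
  obtain ⟨m, hm⟩ := c.exists_rot_pow_eq h.symm
  refine ⟨m, opp.injective ?_⟩
  apply (c.rot ^ m).injective
  rw [rot_pow_opp_turn_pow, hm]

/-- The orbit of a label. -/
def face (d : E × ℤˣ) : c.Face := Quotient.mk _ d

theorem face_base (f : c.Face) : c.face (c.base f) = f := Quotient.out_eq f

theorem face_succ (d : E × ℤˣ) : c.face (c.succ d) = c.face d :=
  Quotient.sound (s := Equiv.Perm.SameCycle.setoid c.succ)
    (Equiv.Perm.sameCycle_apply_left.2 (Equiv.Perm.SameCycle.refl _ _))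

theorem face_succ_pow (d : E × ℤˣ) (k : ℕ) : c.face ((c.succ ^ k) d) = c.face d := by
  induction k with
  | zero => rfl
  | succ k ih => rw [pow_succ', Equiv.Perm.mul_apply, face_succ, ih]

theorem succ_pow_numSides (f : c.Face) : (c.succ ^ c.numSides f) (c.base f) = c.base f := by
  rw [← Equiv.Perm.iterate_eq_pow]
  exact Function.isPeriodicPt_minimalPeriod _ _

theorem succ_zpow_mul_numSides (f : c.Face) (N : ℤ) :
    (c.succ ^ (N * c.numSides f)) (c.base f) = c.base f := by
  rw [mul_comm, zpow_mul, zpow_natCast]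
  exact Function.IsFixedPt.perm_zpow (c.succ_pow_numSides f) N

variable [Finite E]

theorem numSides_pos (f : c.Face) : 0 < c.numSides f :=
  Function.minimalPeriod_pos_of_mem_periodicPts (c.succ.injective.mem_periodicPts _)

theorem exists_succ_pow_base_eq (d : E × ℤˣ) : ∃ k : ℕ, (c.succ ^ k) (c.base (c.face d)) = d := by
  have h : Equiv.Perm.SameCycle c.succ (c.base (c.face d)) d :=
    Quotient.mk_out (s := Equiv.Perm.SameCycle.setoid c.succ) d
  obtain ⟨k, -, hk⟩ := h.exists_pow_eq'
  exact ⟨k, hk⟩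

/-- The number of a side of the polygon of `d` which carries the label `d`; it is determined only
up to multiples of the number of sides. -/
noncomputable def sideIndex (d : E × ℤˣ) : ℕ := (c.exists_succ_pow_base_eq d).choose

theorem succ_pow_sideIndex (d : E × ℤˣ) :
    (c.succ ^ c.sideIndex d) (c.base (c.face d)) = d := (c.exists_succ_pow_base_eq d).choose_spec

end CyclicOrdering

namespace CyclicOrdering

variable {G : OrientedMultigraph V E} (c : G.CyclicOrdering)

/-! ### Half-plane coordinates on the polygons -/

/-- The point `z` of the polygon `f`. It is defined for all complex `z`: the points outside the unit
disk are projected radially to the boundary circle. -/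
noncomputable def pt (f : c.Face) (z : ℂ) : c.Polygons :=
  ⟨f, ⟨(max 1 ‖z‖)⁻¹ • z, by
    have h : 0 < max 1 ‖z‖ := lt_max_of_lt_left one_pos
    rw [mem_closedBall_zero_iff, norm_smul, norm_inv, Real.norm_of_nonneg h.le,
      inv_mul_le_iff₀ h, mul_one]
    exact le_max_right _ _⟩⟩

theorem pt_of_norm_le (f : c.Face) {z : ℂ} (hz : ‖z‖ ≤ 1) :
    c.pt f z = ⟨f, ⟨z, mem_closedBall_zero_iff.2 hz⟩⟩ := by
  have h : (max 1 ‖z‖)⁻¹ • z = z := by simp [max_eq_left hz]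
  exact congrArg (Sigma.mk f) (Subtype.ext h)

theorem continuous_pt (f : c.Face) : Continuous (c.pt f) := by
  have h : Continuous fun z : ℂ => (max 1 ‖z‖)⁻¹ • z := by
    refine Continuous.smul (Continuous.inv₀ (continuous_const.max continuous_norm) fun z => ?_)
      continuous_id
    exact (lt_max_of_lt_left one_pos).ne'
  exact (continuous_sigmaMk (σ := fun _ : c.Face => Metric.closedBall (0 : ℂ) 1)).comp
    (h.subtype_mk _)

theorem exists_pt_eq (q : c.Polygons) : ∃ f, ∃ z : ℂ, ‖z‖ ≤ 1 ∧ c.pt f z = q := by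
  obtain ⟨f, z, hz⟩ := q
  exact ⟨f, z, mem_closedBall_zero_iff.1 hz, c.pt_of_norm_le f (mem_closedBall_zero_iff.1 hz)⟩

theorem pt_eq_pt {f f' : c.Face} {z z' : ℂ} (hz : ‖z‖ ≤ 1) (hz' : ‖z'‖ ≤ 1)
    (h : c.pt f z = c.pt f' z') : f = f' ∧ z = z' := by
  rw [pt_of_norm_le c f hz, pt_of_norm_le c f' hz'] at h
  have h1 : f = f' := congrArg (fun q : c.Polygons => q.1) h
  have h2 : z = z' := congrArg (fun q : c.Polygons => (q.2 : ℂ)) h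
  exact ⟨h1, h2⟩

/-- Points of the polygon `f` near `pt f z` have coordinates in the disk near `z`. -/
theorem mem_nhds_pt {f : c.Face} {z : ℂ} (hz : ‖z‖ ≤ 1) {N : Set c.Polygons}
    (hN : ∀ᶠ u in 𝓝 z, ‖u‖ ≤ 1 → c.pt f u ∈ N) : N ∈ 𝓝 (c.pt f z) := by
  rw [pt_of_norm_le c f hz]
  have h := Sigma.nhds_mk (σ := fun _ : c.Face => Metric.closedBall (0 : ℂ) 1) f
    ⟨z, mem_closedBall_zero_iff.2 hz⟩
  suffices H : Sigma.mk f ⁻¹' N ∈ 𝓝 (⟨z, mem_closedBall_zero_iff.2 hz⟩ :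
      Metric.closedBall (0 : ℂ) 1) from h.symm ▸ H
  rw [nhds_subtype, mem_comap]
  refine ⟨_, hN, fun u hu => ?_⟩
  have hu1 := mem_closedBall_zero_iff.1 u.2
  have := hu hu1
  rwa [pt_of_norm_le c f hu1] at this

/-- The universal covering of the punctured disk of the polygon `f` by the closed lower half-plane,
normalized so that the side number `k` is the image of the real interval `[k, k + 1]`. -/
noncomputable def cover (f : c.Face) (w : ℂ) : ℂ :=
  Complex.exp (-(2 * Real.pi * Complex.I * w / c.numSides f))

theorem norm_cover (f : c.Face) (w : ℂ) :
    ‖c.cover f w‖ = Real.exp (2 * Real.pi * w.im / c.numSides f) := by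
  rw [cover, Complex.norm_exp, Complex.neg_re, Complex.div_natCast_re]
  congr 1
  simp
  ring

theorem bdry_eq (f : c.Face) (x : ℝ) : c.bdry f x = c.pt f (c.cover f x) := by
  rw [pt_of_norm_le c f (by simp [norm_cover])]
  simp only [bdry, cover]
  congr 4
  push_cast
  ring

theorem analyticAt_cover (f : c.Face) (w : ℂ) : AnalyticAt ℂ (c.cover f) w := by
  unfold cover
  fun_prop

variable [Finite E]

theorem numSides_ne_zero (f : c.Face) : (c.numSides f : ℂ) ≠ 0 :=
  Nat.cast_ne_zero.2 (c.numSides_pos f).ne'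

theorem deriv_cover_ne_zero (f : c.Face) (w : ℂ) : deriv (c.cover f) w ≠ 0 := by
  have h : HasDerivAt (c.cover f)
      (Complex.exp (-(2 * Real.pi * Complex.I * w / c.numSides f)) *
        -(2 * Real.pi * Complex.I * 1 / c.numSides f)) w :=
    ((((hasDerivAt_id w).const_mul (2 * Real.pi * Complex.I)).div_const _).neg).cexp
  rw [h.deriv]
  exact mul_ne_zero (Complex.exp_ne_zero _) (neg_ne_zero.2 (div_ne_zero
    (by simp) (c.numSides_ne_zero f)))

theorem norm_cover_le_one_iff (f : c.Face) (w : ℂ) : ‖c.cover f w‖ ≤ 1 ↔ w.im ≤ 0 := by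
  have h : (0 : ℝ) < c.numSides f := Nat.cast_pos.2 (c.numSides_pos f)
  rw [norm_cover, Real.exp_le_one_iff, div_le_iff₀ h, zero_mul]
  exact ⟨fun H => by nlinarith [Real.pi_pos], fun H => by nlinarith [Real.pi_pos]⟩

theorem norm_cover_lt_one_iff (f : c.Face) (w : ℂ) : ‖c.cover f w‖ < 1 ↔ w.im < 0 := by
  have h : (0 : ℝ) < c.numSides f := Nat.cast_pos.2 (c.numSides_pos f)
  rw [norm_cover, Real.exp_lt_one_iff, div_lt_iff₀ h, zero_mul]
  exact ⟨fun H => by nlinarith [Real.pi_pos], fun H => by nlinarith [Real.pi_pos]⟩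

theorem cover_eq_cover_iff (f : c.Face) (w w' : ℂ) :
    c.cover f w = c.cover f w' ↔ ∃ N : ℤ, w = w' + N * c.numSides f := by
  have hn := c.numSides_ne_zero f
  have hpi := Complex.two_pi_I_ne_zero
  rw [cover, cover, Complex.exp_eq_exp_iff_exists_int]
  constructor
  · rintro ⟨N, hN⟩
    refine ⟨-N, mul_left_cancel₀ hpi ?_⟩
    field_simp at hN
    push_cast
    linear_combination -(2 * Real.pi * Complex.I) * hN
  · rintro ⟨N, rfl⟩
    refine ⟨-N, ?_⟩
    field_simp
    push_cast
    ring

/-- Half-plane coordinates at the side labelled `d`: the real interval `[0, 1]` is the side `d`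
itself, walked through clockwise, and the lower half-plane covers the punctured disk. -/
noncomputable def side (d : E × ℤˣ) (w : ℂ) : c.Polygons :=
  c.pt (c.face d) (c.cover (c.face d) (c.sideIndex d + w))

theorem continuous_side (d : E × ℤˣ) : Continuous (c.side d) := by
  have h : Continuous (c.cover (c.face d)) := by
    unfold cover
    fun_prop
  exact (c.continuous_pt _).comp (h.comp (by fun_prop))

theorem norm_cover_side_le (d : E × ℤˣ) {w : ℂ} (hw : w.im ≤ 0) :
    ‖c.cover (c.face d) (c.sideIndex d + w)‖ ≤ 1 := by
  simpa [norm_cover_le_one_iff] using hw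

/-- Half-plane coordinates at a side may be computed from any position of its label. -/
theorem side_eq_pt {f : c.Face} {k : ℕ} {d : E × ℤˣ} (h : (c.succ ^ k) (c.base f) = d) (w : ℂ) :
    c.side d w = c.pt f (c.cover f (k + w)) := by
  have hf : c.face d = f := by rw [← h, face_succ_pow, face_base]
  have h1 := c.succ_pow_sideIndex d
  rw [side, hf]
  rw [hf] at h1
  replace h1 := h1.trans h.symm
  congr 1
  have h2 : c.succ ^ ((c.sideIndex d : ℤ) - k) • c.base f = c.base f := by
    rw [Equiv.Perm.smul_def, sub_eq_neg_add, zpow_add, Equiv.Perm.mul_apply, zpow_natCast, h1,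
      zpow_neg, zpow_natCast, Equiv.Perm.inv_eq_iff_eq]
  obtain ⟨N, hN⟩ := MulAction.zpow_smul_eq_iff_minimalPeriod_dvd.1 h2
  have hN' : (c.sideIndex d : ℤ) - k = c.numSides f * N := hN
  have hN'' : (c.sideIndex d : ℂ) - k = c.numSides f * N := mod_cast hN'
  rw [cover_eq_cover_iff]
  exact ⟨N, by linear_combination hN''⟩

theorem side_succ (d : E × ℤˣ) (w : ℂ) : c.side (c.succ d) w = c.side d (w + 1) := by
  have h : (c.succ ^ (c.sideIndex d + 1)) (c.base (c.face d)) = c.succ d := by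
    rw [pow_succ', Equiv.Perm.mul_apply, succ_pow_sideIndex]
  rw [c.side_eq_pt h, side]
  push_cast
  congr 2
  ring

theorem side_eq_side {d d' : E × ℤˣ} {w w' : ℂ} (hw : w.im ≤ 0) (hw' : w'.im ≤ 0)
    (h : c.side d w = c.side d' w') : ∃ m : ℤ, d' = (c.succ ^ m) d ∧ w = w' + m := by
  obtain ⟨hf, hz⟩ := c.pt_eq_pt (c.norm_cover_side_le d hw) (c.norm_cover_side_le d' hw') h
  have h1 := c.succ_pow_sideIndex d
  have h2 := c.succ_pow_sideIndex d'
  rw [← hf] at h2 hz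
  obtain ⟨N, hN⟩ := (c.cover_eq_cover_iff _ _ _).1 hz
  refine ⟨c.sideIndex d' - c.sideIndex d + N * c.numSides (c.face d), ?_, ?_⟩
  · have h3 : (c.succ ^ (-(c.sideIndex d : ℤ))) d = c.base (c.face d) := by
      rw [zpow_neg, Equiv.Perm.inv_eq_iff_eq, zpow_natCast, h1]
    rw [show (c.sideIndex d' - c.sideIndex d + N * c.numSides (c.face d) : ℤ) =
        c.sideIndex d' + (N * c.numSides (c.face d) + -c.sideIndex d) by ring, zpow_add, zpow_add,
      Equiv.Perm.mul_apply, Equiv.Perm.mul_apply, h3, succ_zpow_mul_numSides, zpow_natCast, h2]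
  · push_cast
    linear_combination hN

/-- A neighbourhood of a point of the polygons, tested in half-plane coordinates. -/
theorem mem_nhds_side {d : E × ℤˣ} {w : ℂ} (hw : w.im ≤ 0) {N : Set c.Polygons}
    (hN : ∀ᶠ u in 𝓝 w, u.im ≤ 0 → c.side d u ∈ N) : N ∈ 𝓝 (c.side d w) := by
  refine c.mem_nhds_pt (c.norm_cover_side_le d hw) ?_
  have ha := c.analyticAt_cover (c.face d) (c.sideIndex d + w)
  rw [← ha.hasStrictDerivAt.map_nhds_eq (c.deriv_cover_ne_zero _ _), eventually_map]
  have hc : Tendsto (fun u : ℂ => u - c.sideIndex d) (𝓝 (c.sideIndex d + w)) (𝓝 w) := by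
    have : Continuous fun u : ℂ => u - c.sideIndex d := by fun_prop
    simpa using this.tendsto (c.sideIndex d + w)
  filter_upwards [hc.eventually hN] with u hu hu'
  have h := hu (by simpa [norm_cover_le_one_iff] using hu')
  simpa [side] using h

end CyclicOrdering

namespace CyclicOrdering

variable {G : OrientedMultigraph V E} (c : G.CyclicOrdering)

/-! ### The fibres of the quotient map -/

/-- The quotient map from the polygons to the cell complex. -/
def toCell (q : c.Polygons) : c.CellComplex := Quot.mk _ q

theorem continuous_toCell : Continuous c.toCell := continuous_quot_mk

theorem toCell_surjective : Function.Surjective c.toCell := Quot.mk_surjective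

theorem isOpen_iff_toCell_preimage {N : Set c.CellComplex} : IsOpen N ↔ IsOpen (c.toCell ⁻¹' N) :=
  Iff.rfl

variable {c}

/-- Sets of points of the polygons which the side identifications respect are unions of fibres of
the quotient map. -/
theorem mem_iff_of_toCell_eq {S : Set c.Polygons} (hS : ∀ q q', c.Glue q q' → (q ∈ S ↔ q' ∈ S))
    {q q' : c.Polygons} (h : c.toCell q = c.toCell q') : q ∈ S ↔ q' ∈ S :=
  iff_of_eq (congrArg (Quot.lift (· ∈ S) fun a b hab => propext (hS a b hab)) h)

variable [Finite E]

theorem bdry_eq_side (f : c.Face) (k : ℕ) (x : ℝ) :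
    c.bdry f (k + x) = c.side ((c.succ ^ k) (c.base f)) x := by
  rw [c.side_eq_pt rfl, bdry_eq]
  push_cast
  rfl

theorem Glue.exists_side {q q' : c.Polygons} (h : c.Glue q q') :
    ∃ d, ∃ t ∈ Icc (0 : ℝ) 1, q = c.side d t ∧ q' = c.side (opp d) (1 - t) := by
  obtain ⟨f, g, k, l, t, ht, h⟩ := h
  refine ⟨_, t, ht, bdry_eq_side f k t, ?_⟩
  rw [bdry_eq_side, h]
  push_cast
  rfl

variable (c) in
theorem toCell_side_opp (d : E × ℤˣ) {t : ℝ} (ht : t ∈ Icc (0 : ℝ) 1) :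
    c.toCell (c.side d t) = c.toCell (c.side (opp d) (1 - t)) := by
  have h1 := c.succ_pow_sideIndex d
  have h2 := c.succ_pow_sideIndex (opp d)
  have h := Glue.side (c := c) (c.face d) (c.face (opp d)) _ _ t ht (by rw [h1, h2])
  rw [bdry_eq_side, bdry_eq_side, h1, h2] at h
  push_cast at h
  exact Quot.sound h

/-- The distance from the centre of the polygon, as a function on the polygons. -/
noncomputable def radius (q : c.Polygons) : ℝ := ‖(q.2 : ℂ)‖

/-- The real part of the `n`-th power on a polygon with `n` sides. On the boundary it is
`cos (2 * π * x)` in terms of the side parameter `x`, so that it respects the side identifications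
and takes the value `1` exactly at the corners. -/
noncomputable def powRe (q : c.Polygons) : ℝ := ((q.2 : ℂ) ^ c.numSides q.1).re

omit [Finite E] in
theorem radius_pt (f : c.Face) {z : ℂ} (hz : ‖z‖ ≤ 1) : radius (c.pt f z) = ‖z‖ := by
  rw [pt_of_norm_le c f hz]
  rfl

omit [Finite E] in
theorem continuous_radius : Continuous (radius : c.Polygons → ℝ) :=
  continuous_sigma (σ := fun _ : c.Face => Metric.closedBall (0 : ℂ) 1)
    fun _ => continuous_norm.comp continuous_subtype_val

omit [Finite E] in
theorem continuous_powRe : Continuous (powRe : c.Polygons → ℝ) :=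
  continuous_sigma (σ := fun _ : c.Face => Metric.closedBall (0 : ℂ) 1)
    fun f => Complex.continuous_re.comp
      ((continuous_pow (c.numSides f)).comp continuous_subtype_val)

theorem radius_side (d : E × ℤˣ) {w : ℂ} (hw : w.im ≤ 0) :
    radius (c.side d w) = ‖c.cover (c.face d) (c.sideIndex d + w)‖ :=
  radius_pt _ (c.norm_cover_side_le d hw)

theorem radius_side_lt_one (d : E × ℤˣ) {w : ℂ} (hw : w.im < 0) : radius (c.side d w) < 1 := by
  rw [radius_side d hw.le, norm_cover_lt_one_iff]
  simpa using hw

theorem radius_side_ofReal (d : E × ℤˣ) (x : ℝ) : radius (c.side d x) = 1 := by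
  rw [radius_side d (by simp), norm_cover]
  simp

theorem radius_side_one_sub (d : E × ℤˣ) (t : ℝ) : radius (c.side d (1 - t)) = 1 := by
  rw [← radius_side_ofReal d (1 - t)]
  push_cast
  rfl

theorem powRe_side_ofReal (d : E × ℤˣ) (x : ℝ) :
    powRe (c.side d x) = Real.cos (2 * Real.pi * x) := by
  have hn := c.numSides_ne_zero (c.face d)
  rw [side, pt_of_norm_le c _ (c.norm_cover_side_le d (by simp))]
  change (c.cover (c.face d) (c.sideIndex d + x) ^ c.numSides (c.face d)).re = _
  rw [cover, ← Complex.exp_nat_mul, mul_neg, mul_div_cancel₀ _ hn,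
    show -(2 * Real.pi * Complex.I * (c.sideIndex d + x)) =
      ((-(2 * Real.pi * x) : ℝ) : ℂ) * Complex.I - c.sideIndex d * (2 * Real.pi * Complex.I) by
      push_cast; ring,
    Complex.exp_periodic.sub_nat_mul_eq, Complex.exp_ofReal_mul_I_re, Real.cos_neg]

theorem radius_eq_of_glue {q q' : c.Polygons} (h : c.Glue q q') : radius q = radius q' := by
  obtain ⟨d, t, -, rfl, rfl⟩ := h.exists_side
  rw [radius_side_ofReal, radius_side_one_sub]

theorem powRe_eq_of_glue {q q' : c.Polygons} (h : c.Glue q q') : powRe q = powRe q' := by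
  obtain ⟨d, t, -, rfl, rfl⟩ := h.exists_side
  have := powRe_side_ofReal (c := c) (opp d) (1 - t)
  push_cast at this
  rw [powRe_side_ofReal, this, show 2 * Real.pi * (1 - t) = 2 * Real.pi - 2 * Real.pi * t by ring,
    Real.cos_two_pi_sub]

/-- The function induced by `radius` on the cell complex; it is `1` exactly on the graph. -/
noncomputable def cellRadius : c.CellComplex → ℝ := Quot.lift radius fun _ _ => radius_eq_of_glue

/-- The function induced by `powRe` on the cell complex. -/
noncomputable def cellPowRe : c.CellComplex → ℝ := Quot.lift powRe fun _ _ => powRe_eq_of_glue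

theorem continuous_cellRadius : Continuous (cellRadius : c.CellComplex → ℝ) :=
  continuous_quot_lift _ continuous_radius

theorem continuous_cellPowRe : Continuous (cellPowRe : c.CellComplex → ℝ) :=
  continuous_quot_lift _ continuous_powRe

theorem cellPowRe_toCell (q : c.Polygons) : cellPowRe (c.toCell q) = powRe q := rfl

theorem radius_eq_of_toCell_eq {q q' : c.Polygons} (h : c.toCell q = c.toCell q') :
    radius q = radius q' :=
  congrArg cellRadius h

/-- Interior points of the polygons are not identified with any other point. -/
theorem eq_of_toCell_eq {q q' : c.Polygons} (hq : radius q < 1) (h : c.toCell q' = c.toCell q) :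
    q' = q := by
  refine (mem_iff_of_toCell_eq (S := {q}) (fun a b hab => ?_) h.symm).1 rfl
  obtain ⟨d, t, -, rfl, rfl⟩ := hab.exists_side
  have h1 := radius_side_ofReal (c := c) d t
  have h2 := radius_side_one_sub (c := c) (opp d) t
  constructor <;> rintro rfl <;> linarith

theorem int_eq_zero_of_abs_lt {m : ℤ} (h : |(m : ℝ)| < 1) : m = 0 := by
  rw [← Int.abs_lt_one_iff]
  exact_mod_cast h

/-- Half-plane coordinates are unique within a vertical strip of width one. -/
theorem eq_and_eq_of_side_eq {d d' : E × ℤˣ} {w w' : ℂ} (hw : w.im ≤ 0) (hw' : w'.im ≤ 0)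
    (hre : |w.re - w'.re| < 1) (h : c.side d w = c.side d' w') : d' = d ∧ w = w' := by
  obtain ⟨m, hd, rfl⟩ := c.side_eq_side hw hw' h
  have hm : m = 0 := int_eq_zero_of_abs_lt (by simpa using hre)
  subst hm
  simpa using hd

/-- An interior point of a side is identified with exactly one other point, on the opposite side. -/
theorem toCell_eq_side_iff {d : E × ℤˣ} {t : ℝ} (ht : t ∈ Ioo (0 : ℝ) 1) {q : c.Polygons} :
    c.toCell q = c.toCell (c.side d t) ↔ q = c.side d t ∨ q = c.side (opp d) (1 - t) := by
  constructor
  · intro h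
    have key : ∀ (d : E × ℤˣ) (t : ℝ), t ∈ Ioo (0 : ℝ) 1 → ∀ d' : E × ℤˣ, ∀ t' ∈ Icc (0 : ℝ) 1,
        c.side d' t' = c.side d t → d' = d ∧ t' = t := by
      intro d t ht d' t' ht' h
      have hre : |(t' : ℂ).re - (t : ℂ).re| < 1 := by
        simp only [Complex.ofReal_re]
        rw [abs_lt]
        constructor <;> linarith [ht.1, ht.2, ht'.1, ht'.2]
      obtain ⟨h1, h2⟩ := eq_and_eq_of_side_eq (by simp) (by simp) hre h
      exact ⟨h1.symm, by exact_mod_cast h2⟩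
    have h1t : (1 - t) ∈ Ioo (0 : ℝ) 1 := ⟨by linarith [ht.2], by linarith [ht.1]⟩
    refine (mem_iff_of_toCell_eq
      (S := {q | q = c.side d t ∨ q = c.side (opp d) (1 - t)}) (fun a b hab => ?_) h).2 (Or.inl rfl)
    obtain ⟨d', t', ht', rfl, rfl⟩ := hab.exists_side
    have ht'' : (1 - t') ∈ Icc (0 : ℝ) 1 := ⟨by linarith [ht'.2], by linarith [ht'.1]⟩
    have k1 := key d t ht d' t' ht'
    have k2 := key (opp d) (1 - t) h1t d' t' ht'
    have k3 := key d t ht (opp d') (1 - t') ht''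
    have k4 := key (opp d) (1 - t) h1t (opp d') (1 - t') ht''
    push_cast at k1 k2 k3 k4
    constructor
    · rintro (h | h)
      · obtain ⟨rfl, rfl⟩ := k1 h
        exact Or.inr rfl
      · obtain ⟨rfl, rfl⟩ := k2 h
        left
        rw [opp_opp]
        push_cast
        ring_nf
    · rintro (h | h)
      · obtain ⟨rfl, rfl⟩ := k3 h
        right
        rw [opp_opp]
        push_cast
        ring_nf
      · obtain ⟨h1, h2⟩ := k4 h
        obtain rfl := opp.injective h1
        obtain rfl : t' = t := by linarith
        exact Or.inl rfl
  · rintro (rfl | rfl)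
    · rfl
    · exact (c.toCell_side_opp d ⟨ht.1.le, ht.2.le⟩).symm

theorem toCell_side_turn_zero (d : E × ℤˣ) :
    c.toCell (c.side (c.turn d) 0) = c.toCell (c.side d 0) := by
  obtain ⟨d, rfl⟩ := c.succ.surjective d
  have := c.toCell_side_opp d (t := 1) (by simp)
  push_cast at this
  rw [turn_succ, side_succ, zero_add, this, sub_self]

theorem toCell_side_turn_pow_zero (d : E × ℤˣ) (m : ℕ) :
    c.toCell (c.side ((c.turn ^ m) d) 0) = c.toCell (c.side d 0) := by
  induction m with
  | zero => rfl
  | succ m ih => rw [pow_succ', Equiv.Perm.mul_apply, toCell_side_turn_zero, ih]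

/-- The corners identified with the initial corner of `d` are the initial corners of the sides
`turn ^ m d`: the vertices of the cell complex are those of the graph. -/
theorem exists_turn_pow_of_toCell_eq {d : E × ℤˣ} {q : c.Polygons}
    (h : c.toCell q = c.toCell (c.side d 0)) : ∃ m : ℕ, q = c.side ((c.turn ^ m) d) 0 := by
  suffices H : ∃ d', G.inc (opp d') = G.inc (opp d) ∧ q = c.side d' 0 by
    obtain ⟨d', hd', rfl⟩ := H
    obtain ⟨m, rfl⟩ := c.exists_turn_pow_eq hd'.symm
    exact ⟨m, rfl⟩
  refine (mem_iff_of_toCell_eq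
    (S := {q | ∃ d', G.inc (opp d') = G.inc (opp d) ∧ q = c.side d' 0}) (fun a b hab => ?_) h).2
    ⟨d, rfl, rfl⟩
  obtain ⟨e, t, ht, rfl, rfl⟩ := hab.exists_side
  -- a point of a side which is a corner is one of its two end points
  have key : ∀ e d' : E × ℤˣ, ∀ t ∈ Icc (0 : ℝ) 1, c.side e t = c.side d' 0 →
      (t = 0 ∧ d' = e) ∨ (t = 1 ∧ d' = c.succ e) := by
    intro e d' t ht h
    rcases ht.2.lt_or_eq with ht1 | rfl
    · obtain ⟨h1, h2⟩ := eq_and_eq_of_side_eq (w := t) (w' := 0) (by simp) (by simp)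
        (by simpa [abs_lt] using ⟨by linarith [ht.1], ht1⟩) h
      exact Or.inl ⟨by exact_mod_cast h2, h1⟩
    · have h' : c.side (c.succ e) 0 = c.side d' 0 := by
        rw [side_succ, zero_add, ← h]
        simp
      exact Or.inr ⟨rfl, (eq_and_eq_of_side_eq (by simp) (by simp) (by simp) h').1⟩
  have inc_succ : ∀ e, G.inc (opp (c.succ e)) = G.inc e := fun e => by rw [opp_succ, inc_rot]
  have half : ∀ (e : E × ℤˣ), ∀ t ∈ Icc (0 : ℝ) 1,
      (∃ d', G.inc (opp d') = G.inc (opp d) ∧ c.side e t = c.side d' 0) →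
      ∃ d', G.inc (opp d') = G.inc (opp d) ∧ c.side (opp e) (1 - t) = c.side d' 0 := by
    rintro e t ht ⟨d', hd', h⟩
    rcases key e d' t ht h with ⟨rfl, rfl⟩ | ⟨rfl, rfl⟩
    · refine ⟨c.succ (opp d'), by rw [inc_succ, hd'], ?_⟩
      rw [side_succ]
      simp
    · refine ⟨opp e, by rw [opp_opp, ← hd', inc_succ], ?_⟩
      simp
  refine ⟨half e t ht, fun H => ?_⟩
  have := half (opp e) (1 - t) ⟨by linarith [ht.2], by linarith [ht.1]⟩ (by push_cast; exact H)
  rw [opp_opp] at this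
  push_cast at this
  rwa [sub_sub_cancel] at this

theorem side_succ_zpow (d : E × ℤˣ) (m : ℤ) (w : ℂ) :
    c.side ((c.succ ^ m) d) w = c.side d (w + m) := by
  induction m generalizing w with
  | zero => simp
  | succ m ih =>
    rw [add_comm, zpow_one_add, Equiv.Perm.mul_apply, side_succ, ih]
    push_cast
    ring_nf
  | pred m ih =>
    have h : c.succ ((c.succ ^ (-(m : ℤ) - 1)) d) = (c.succ ^ (-(m : ℤ))) d := by
      rw [← Equiv.Perm.mul_apply, ← zpow_one_add]
      congr 2
      ring
    have h2 := ih (w - 1)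
    rw [← h, side_succ, sub_add_cancel] at h2
    rw [h2]
    push_cast
    ring_nf

/-- The boundary of the polygons is covered by the sides without their terminal corners. -/
theorem exists_side_of_radius_eq_one {q : c.Polygons} (h : radius q = 1) :
    ∃ d, ∃ t ∈ Ico (0 : ℝ) 1, q = c.side d t := by
  obtain ⟨f, z, hz, rfl⟩ := c.exists_pt_eq q
  rw [radius_pt f hz] at h
  obtain ⟨θ, rfl⟩ := Complex.norm_eq_one_iff z |>.1 h
  have hn := c.numSides_ne_zero f
  let x : ℝ := -(θ * c.numSides f / (2 * Real.pi))
  refine ⟨(c.succ ^ ⌊x⌋) (c.base f), Int.fract x, ⟨Int.fract_nonneg x, Int.fract_lt_one x⟩, ?_⟩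
  have hx : ((Int.fract x : ℝ) : ℂ) + ⌊x⌋ = (x : ℝ) := mod_cast Int.fract_add_floor x
  rw [side_succ_zpow, hx, c.side_eq_pt (f := f) (k := 0) (d := c.base f) rfl, cover]
  congr 2
  simp only [x]
  push_cast
  field_simp
  ring

end CyclicOrdering

namespace CyclicOrdering

variable {G : OrientedMultigraph V E} (c : G.CyclicOrdering)

/-! ### Conformal parametrizations of the cell complex -/

/-- The parametrizations of the cell complex: by the interior of a polygon, by a vertical strip
around the side `d`, and by a disk around the initial corner of `d`. -/
inductive ParamIndex : Type _
  | center (f : c.Face)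
  | edge (d : E × ℤˣ)
  | vertex (d : E × ℤˣ)

variable [Finite E]

/-- The half-plane coordinates of the two polygons at the side `d` fit together to a parametrization
by the vertical strip over the open unit interval. -/
noncomputable def edgeParam (d : E × ℤˣ) (w : ℂ) : c.CellComplex :=
  if w.im ≤ 0 then c.toCell (c.side d w) else c.toCell (c.side (opp d) (1 - w))

/-- At the initial corner of `d` four half-planes, with the coordinate `w`, meet. They are the
images of the four quadrants of the `ζ`-plane under `w = ± ζ ^ 2`. The quadrants are taken
half-open, so that multiplication by `I` permutes the cases; the point `0`, where all cases agree, falls under the last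
one. -/
noncomputable def vertexParam (d : E × ℤˣ) (ζ : ℂ) : c.CellComplex :=
  if 0 < ζ.re ∧ ζ.im ≤ 0 then c.toCell (c.side d (ζ ^ 2))
  else if ζ.re ≤ 0 ∧ ζ.im < 0 then c.toCell (c.side (c.turn d) (-ζ ^ 2))
  else if ζ.re < 0 ∧ 0 ≤ ζ.im then c.toCell (c.side ((c.turn ^ 2) d) (ζ ^ 2))
  else c.toCell (c.side ((c.turn ^ 3) d) (-ζ ^ 2))

/-- The parametrization with a given index. -/
noncomputable def param : c.ParamIndex → ℂ → c.CellComplex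
  | .center f => fun z => c.toCell (c.pt f z)
  | .edge d => c.edgeParam d
  | .vertex d => c.vertexParam d

omit [Finite E] in
variable {c} in
/-- The domain on which a parametrization is injective. -/
def paramDomain : c.ParamIndex → Set ℂ
  | .center _ => {z | ‖z‖ < 1}
  | .edge _ => {w | 0 < w.re ∧ w.re < 1}
  | .vertex _ => {ζ | ‖ζ ^ 2‖ < 1 / 2}

omit [Finite E] in
theorem isOpen_paramDomain (i : c.ParamIndex) : IsOpen (paramDomain i) := by
  cases i with
  | center f => exact isOpen_lt continuous_norm continuous_const
  | edge d =>
    exact (isOpen_lt continuous_const Complex.continuous_re).inter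
      (isOpen_lt Complex.continuous_re continuous_const)
  | vertex d => exact isOpen_lt (continuous_pow 2).norm continuous_const

theorem edgeParam_of_im_nonpos (d : E × ℤˣ) {w : ℂ} (hw : w.im ≤ 0) :
    c.edgeParam d w = c.toCell (c.side d w) := if_pos hw

theorem edgeParam_ofReal (d : E × ℤˣ) (t : ℝ) : c.edgeParam d t = c.toCell (c.side d t) :=
  c.edgeParam_of_im_nonpos d (by simp)

theorem edgeParam_opp (d : E × ℤˣ) {w : ℂ} (h0 : 0 < w.re) (h1 : w.re < 1) :
    c.edgeParam (opp d) (1 - w) = c.edgeParam d w := by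
  rcases lt_trichotomy w.im 0 with h | h | h
  · rw [edgeParam, edgeParam, if_neg (by simpa using h), if_pos h.le, opp_opp, sub_sub_cancel]
  · obtain ⟨t, rfl⟩ : ∃ t : ℝ, w = t := ⟨w.re, Complex.ext rfl (by simp [h])⟩
    rw [edgeParam, if_pos (by simp), edgeParam_ofReal, c.toCell_side_opp d]
    exact ⟨by simpa using h0.le, by simpa using h1.le⟩
  · rw [edgeParam, edgeParam, if_pos (by simpa using h.le), if_neg h.not_ge]

theorem vertexParam_zero (d : E × ℤˣ) : c.vertexParam d 0 = c.toCell (c.side d 0) := by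
  simp [vertexParam, toCell_side_turn_pow_zero]

/-- Passing to the next corner rotates the disk around a vertex by a quarter turn. -/
theorem vertexParam_turn (d : E × ℤˣ) (ζ : ℂ) :
    c.vertexParam (c.turn d) (Complex.I * ζ) = c.vertexParam d ζ := by
  by_cases h0 : ζ = 0
  · rw [h0, mul_zero, vertexParam_zero, vertexParam_zero, toCell_side_turn_zero]
  have h2 : (c.turn ^ 2) d = c.turn (c.turn d) := rfl
  have h3 : (c.turn ^ 3) d = (c.turn ^ 2) (c.turn d) := rfl
  have h4 : (c.turn ^ 3) (c.turn d) = d := c.turn_pow_four d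
  have hne : ¬(ζ.re = 0 ∧ ζ.im = 0) := fun h => h0 (Complex.ext h.1 h.2)
  simp only [vertexParam, Complex.I_mul_re, Complex.I_mul_im, mul_pow, Complex.I_sq, h2, h3, h4,
    neg_mul, one_mul, neg_neg, Left.neg_pos_iff, Left.neg_nonpos_iff, Left.neg_neg_iff]
  split_ifs <;> first | rfl | grind

theorem vertexParam_turn_pow (d : E × ℤˣ) (m : ℕ) (ζ : ℂ) :
    c.vertexParam ((c.turn ^ m) d) (Complex.I ^ m * ζ) = c.vertexParam d ζ := by
  induction m with
  | zero => simp
  | succ m ih =>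
    rw [pow_succ', pow_succ', Equiv.Perm.mul_apply, mul_assoc, vertexParam_turn, ih]

omit [Finite E] in
theorem turn_pow_three (d : E × ℤˣ) : (c.turn ^ 3) d = c.succ (opp d) := by
  apply c.turn.injective
  rw [turn_succ, opp_opp, ← Equiv.Perm.mul_apply, ← pow_succ', turn_pow_four]

/-- On the right half-plane, only the two polygons at the edge of `d` are involved, and the disk
around a vertex has the edge coordinate `ζ ^ 2`. -/
theorem vertexParam_eq_edgeParam (d : E × ℤˣ) {ζ : ℂ} (hζ : 0 < ζ.re) :
    c.vertexParam d ζ = c.edgeParam d (ζ ^ 2) := by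
  have him : (ζ ^ 2).im = 2 * ζ.re * ζ.im := by rw [pow_two, Complex.mul_im]; ring
  by_cases h : ζ.im ≤ 0
  · rw [vertexParam, if_pos ⟨hζ, h⟩, edgeParam, if_pos]
    rw [him]
    exact mul_nonpos_of_nonneg_of_nonpos (by positivity) h
  · rw [vertexParam, if_neg (fun H => h H.2), if_neg (fun H => hζ.not_ge H.1),
      if_neg (fun H => hζ.not_gt H.1), edgeParam, if_neg, turn_pow_three, side_succ,
      neg_add_eq_sub]
    rw [him, not_le]
    have := not_le.1 h
    positivity

/-- On the closed fourth quadrant the parametrization at a corner is given by `w = ζ ^ 2`. -/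
theorem vertexParam_of_quadrant (d : E × ℤˣ) {ζ : ℂ} (hre : 0 ≤ ζ.re) (him : ζ.im ≤ 0)
    (hζ : ‖ζ‖ ≤ 1) : c.vertexParam d ζ = c.toCell (c.side d (ζ ^ 2)) := by
  rcases hre.lt_or_eq with hre | hre
  · rw [vertexParam, if_pos ⟨hre, him⟩]
  -- the boundary ray belongs to the next half-open quadrant, and its two descriptions are glued
  rcases him.lt_or_eq with him | him
  · rw [vertexParam, if_neg (fun H => H.1.ne hre), if_pos ⟨hre.symm.le, him⟩]
    have hsq : ζ ^ 2 = ((-ζ.im ^ 2 : ℝ) : ℂ) := by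
      apply Complex.ext <;> simp [pow_two, Complex.mul_re, Complex.mul_im, ← hre]
    have hle : ζ.im ^ 2 ≤ 1 := by
      have h := (Complex.abs_im_le_norm ζ).trans hζ
      rwa [sq_le_one_iff_abs_le_one]
    obtain ⟨e, rfl⟩ := c.succ.surjective d
    have h := c.toCell_side_opp (opp e) (t := ζ.im ^ 2) ⟨sq_nonneg _, hle⟩
    rw [opp_opp] at h
    push_cast at h
    rw [hsq, turn_succ, side_succ]
    push_cast
    rw [neg_neg, neg_add_eq_sub, h]
  · obtain rfl : ζ = 0 := Complex.ext hre.symm him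
    rw [vertexParam_zero]
    simp

omit [Finite E] in
/-- Every nonzero point is moved by a power of `I` to a half-open quadrant. -/
theorem exists_I_pow_mul_quadrant {ζ : ℂ} (hζ : ζ ≠ 0) :
    ∃ m : ℕ, 0 < (Complex.I ^ m * ζ).re ∧ (Complex.I ^ m * ζ).im ≤ 0 := by
  have hne : ¬(ζ.re = 0 ∧ ζ.im = 0) := fun h => hζ (Complex.ext h.1 h.2)
  by_cases h0 : 0 < ζ.re ∧ ζ.im ≤ 0
  · exact ⟨0, by simpa using h0⟩
  by_cases h1 : ζ.re ≤ 0 ∧ ζ.im < 0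
  · exact ⟨1, by simpa using h1.symm⟩
  by_cases h2 : ζ.re < 0 ∧ 0 ≤ ζ.im
  · exact ⟨2, by simpa using h2⟩
  · refine ⟨3, ?_⟩
    simp only [Complex.I_pow_three, neg_mul, Complex.neg_re, Complex.neg_im, Complex.I_mul_re,
      Complex.I_mul_im]
    grind

/-! ### Changes of coordinates -/

theorem related_edge_opp (d : E × ℤˣ) {w : ℂ} (h0 : 0 < w.re) (h1 : w.re < 1) :
    ConformallyRelated c.param (.edge d) w (.edge (opp d)) (1 - w) := by
  have hd : HasDerivAt (fun u : ℂ => 1 - u) (-1) w := by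
    simpa using (hasDerivAt_id w).const_sub 1
  refine ⟨fun u => 1 - u, by fun_prop, by rw [hd.deriv]; simp, rfl, ?_⟩
  filter_upwards [(c.isOpen_paramDomain (.edge d)).mem_nhds ⟨h0, h1⟩] with u hu
  exact (c.edgeParam_opp d hu.1 hu.2).symm

theorem related_vertex_turn_pow (d : E × ℤˣ) (m : ℕ) (ζ : ℂ) :
    ConformallyRelated c.param (.vertex d) ζ (.vertex ((c.turn ^ m) d)) (Complex.I ^ m * ζ) := by
  have hd : HasDerivAt (fun u : ℂ => Complex.I ^ m * u) (Complex.I ^ m) ζ := by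
    simpa using (hasDerivAt_id ζ).const_mul (Complex.I ^ m)
  exact ⟨fun u => Complex.I ^ m * u, by fun_prop, by rw [hd.deriv]; simp, rfl,
    Eventually.of_forall fun u => (c.vertexParam_turn_pow d m u).symm⟩

theorem related_vertex_edge (d : E × ℤˣ) {ζ : ℂ} (hζ : 0 < ζ.re) :
    ConformallyRelated c.param (.vertex d) ζ (.edge d) (ζ ^ 2) := by
  have h0 : ζ ≠ 0 := by
    rintro rfl
    simp at hζ
  refine ⟨fun u => u ^ 2, by fun_prop, by simpa using h0, rfl, ?_⟩
  filter_upwards [(isOpen_lt continuous_const Complex.continuous_re).mem_nhds hζ] with u hu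
  exact c.vertexParam_eq_edgeParam d hu

/-- Off the real axis, the edge coordinate is a logarithmic coordinate of a polygon. -/
theorem related_edge_center (d : E × ℤˣ) {w : ℂ} (hw : w.im < 0) :
    ConformallyRelated c.param (.edge d) w (.center (c.face d))
      (c.cover (c.face d) (c.sideIndex d + w)) := by
  have hd := (c.analyticAt_cover (c.face d) (c.sideIndex d + w)).differentiableAt.hasDerivAt
  have hd' := hd.comp_const_add (c.sideIndex d : ℂ) w
  refine ⟨fun u => c.cover (c.face d) (c.sideIndex d + u), ?_, ?_, rfl, ?_⟩
  · exact (c.analyticAt_cover _ _).fun_comp (f := fun u : ℂ => (c.sideIndex d : ℂ) + u)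
      (by fun_prop)
  · rw [hd'.deriv]
    exact c.deriv_cover_ne_zero _ _
  · filter_upwards [(isOpen_lt Complex.continuous_im continuous_const).mem_nhds hw] with u hu
    exact c.edgeParam_of_im_nonpos d (le_of_lt hu)

/-- The types of points of the cell complex, each in the parametrization which suits it best: points
in the interior of a polygon, points in the interior of an edge and vertices. -/
inductive IsStandard : c.ParamIndex → ℂ → Prop
  | center (f : c.Face) (z : ℂ) (hz : ‖z‖ < 1) : IsStandard (.center f) z
  | edge (d : E × ℤˣ) (t : ℝ) (ht : t ∈ Ioo (0 : ℝ) 1) : IsStandard (.edge d) t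
  | vertex (d : E × ℤˣ) : IsStandard (.vertex d) 0

theorem exists_standard_of_edge_of_im_nonpos (d : E × ℤˣ) {w : ℂ} (h0 : 0 < w.re) (h1 : w.re < 1)
    (hw : w.im ≤ 0) :
    ∃ j x, c.IsStandard j x ∧ ConformallyRelated c.param (.edge d) w j x := by
  rcases hw.lt_or_eq with hw | hw
  · refine ⟨_, _, .center _ _ ?_, c.related_edge_center d hw⟩
    simpa [norm_cover_lt_one_iff] using hw
  · obtain ⟨t, rfl⟩ : ∃ t : ℝ, w = t := ⟨w.re, Complex.ext rfl (by simp [hw])⟩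
    exact ⟨_, _, .edge d t ⟨by simpa using h0, by simpa using h1⟩, .refl _ _ _⟩

/-- Every point of every parametrization is standard after a conformal change of coordinates. -/
theorem exists_standard {i : c.ParamIndex} {z : ℂ} (hz : z ∈ paramDomain i) :
    ∃ j x, c.IsStandard j x ∧ ConformallyRelated c.param i z j x := by
  cases i with
  | center f => exact ⟨_, _, .center f z hz, .refl _ _ _⟩
  | edge d =>
    rcases le_total z.im 0 with h | h
    · exact c.exists_standard_of_edge_of_im_nonpos d hz.1 hz.2 h
    · obtain ⟨j, x, hj, hx⟩ := c.exists_standard_of_edge_of_im_nonpos (opp d) (w := 1 - z)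
        (by simpa using hz.2) (by simpa using hz.1) (by simpa using h)
      exact ⟨j, x, hj, (c.related_edge_opp d hz.1 hz.2).trans hx⟩
  | vertex d =>
    by_cases h0 : z = 0
    · subst h0
      exact ⟨_, _, .vertex d, .refl _ _ _⟩
    obtain ⟨m, hm, hm'⟩ := exists_I_pow_mul_quadrant h0
    have h := (c.related_vertex_turn_pow d m z).trans (c.related_vertex_edge _ hm)
    have him : ((Complex.I ^ m * z) ^ 2).im ≤ 0 := by
      rw [pow_two, Complex.mul_im]
      nlinarith
    have hnorm : ‖(Complex.I ^ m * z) ^ 2‖ < 1 / 2 := by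
      simpa [paramDomain] using hz
    rcases him.lt_or_eq with him | him
    · refine ⟨_, _, .center _ _ ?_, h.trans (c.related_edge_center _ him)⟩
      simpa only [norm_cover_lt_one_iff, Complex.add_im, Complex.natCast_im, zero_add] using him
    · have hre : 0 < ((Complex.I ^ m * z) ^ 2).re := by
        have hz' : (Complex.I ^ m * z).im = 0 := by
          rw [pow_two, Complex.mul_im] at him
          nlinarith
        rw [pow_two, Complex.mul_re, hz']
        nlinarith
      have hlt := (Complex.re_le_norm _).trans_lt hnorm
      obtain ⟨j, x, hj, hx⟩ := c.exists_standard_of_edge_of_im_nonpos ((c.turn ^ m) d)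
        hre (by linarith) him.le
      exact ⟨j, x, hj, h.trans hx⟩

end CyclicOrdering

namespace CyclicOrdering

variable {G : OrientedMultigraph V E} (c : G.CyclicOrdering) [Finite E]

/-! ### The parametrizations are open and injective -/

theorem map_edgeParam_le (d : E × ℤˣ) (t : ℝ) {q : c.Polygons} (hq : q = c.side d t) :
    map c.toCell (𝓝 q) ≤ map (c.edgeParam d) (𝓝 t) := by
  subst hq
  intro N hN
  refine c.mem_nhds_side (by simp) ?_
  filter_upwards [hN] with u hu hu'
  rwa [mem_preimage, edgeParam_of_im_nonpos c d hu'] at hu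

/-- Every point of the half-plane near the corner `0` is the square of a point of the fourth
quadrant, so the disk around a vertex covers a neighbourhood of the corner. -/
theorem map_vertexParam_le (d : E × ℤˣ) :
    map c.toCell (𝓝 (c.side d 0)) ≤ map (c.vertexParam d) (𝓝 0) := by
  intro N hN
  refine c.mem_nhds_side (by simp) ?_
  obtain ⟨ε, hε, hN⟩ := Metric.eventually_nhds_iff_ball.1 hN
  have hε' : 0 < min ε 1 := lt_min hε one_pos
  filter_upwards [Metric.ball_mem_nhds 0 (pow_pos hε' 2)] with w hw him
  rw [mem_ball_zero_iff] at hw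
  -- the square root of `w` in the fourth quadrant
  obtain ⟨u, hre, hui, rfl⟩ : ∃ u : ℂ, 0 ≤ u.re ∧ u.im ≤ 0 ∧ u ^ 2 = w := by
    obtain ⟨u, hu⟩ := IsAlgClosed.exists_pow_nat_eq w (n := 2) (by norm_num)
    have hu' : u.re * u.im ≤ 0 := by
      rw [← hu, pow_two, Complex.mul_im] at him
      linarith
    rcases mul_nonpos_iff.1 hu' with h | h
    · exact ⟨u, h.1, h.2, hu⟩
    · exact ⟨-u, by simpa using h.1, by simpa using h.2, by rw [neg_sq, hu]⟩
  rw [norm_pow] at hw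
  have hu := lt_of_pow_lt_pow_left₀ 2 hε'.le hw
  have h := hN u (mem_ball_zero_iff.2 (hu.trans_le (min_le_left _ _)))
  rwa [vertexParam_of_quadrant c d hre hui (hu.le.trans (min_le_right _ _))] at h

theorem continuousAt_edgeParam (d : E × ℤˣ) {t : ℝ} (ht : t ∈ Ioo (0 : ℝ) 1) :
    ContinuousAt (c.edgeParam d) t := by
  have h1 : Continuous fun w => c.toCell (c.side d w) :=
    c.continuous_toCell.comp (c.continuous_side d)
  have h2 : Continuous fun w : ℂ => c.toCell (c.side (opp d) (1 - w)) :=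
    c.continuous_toCell.comp ((c.continuous_side _).comp (by fun_prop))
  rw [ContinuousAt, edgeParam_ofReal]
  have h2' := h2.tendsto t
  rw [← c.toCell_side_opp d ⟨ht.1.le, ht.2.le⟩] at h2'
  exact (h1.tendsto (t : ℂ)).if' h2'

theorem continuousAt_vertexParam (d : E × ℤˣ) : ContinuousAt (c.vertexParam d) 0 := by
  have key : ∀ (m : ℕ) (f : ℂ → ℂ), Continuous f → f 0 = 0 →
      Tendsto (fun ζ => c.toCell (c.side ((c.turn ^ m) d) (f ζ))) (𝓝 0)
        (𝓝 (c.toCell (c.side d 0))) := by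
    intro m f hf hf0
    have h : Continuous fun ζ => c.toCell (c.side ((c.turn ^ m) d) (f ζ)) :=
      c.continuous_toCell.comp ((c.continuous_side _).comp hf)
    have h' := h.tendsto 0
    rwa [hf0, toCell_side_turn_pow_zero] at h'
  rw [ContinuousAt, vertexParam_zero]
  have hp : Continuous fun ζ : ℂ => ζ ^ 2 := by fun_prop
  have hm : Continuous fun ζ : ℂ => -ζ ^ 2 := by fun_prop
  exact (key 0 _ hp (by simp)).if' ((key 1 _ hm (by simp)).if'
    ((key 2 _ hp (by simp)).if' (key 3 _ hm (by simp))))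

/-- At a standard point the parametrization is continuous, and, in the form appropriate to the
quotient topology, open: its values near the point contain the classes of all points of the polygons near any
representative. -/
theorem IsStandard.map_le {i : c.ParamIndex} {z : ℂ} (h : c.IsStandard i z) :
    map (c.param i) (𝓝 z) ≤ 𝓝 (c.param i z) ∧
      ∀ q, c.toCell q = c.param i z → map c.toCell (𝓝 q) ≤ map (c.param i) (𝓝 z) := by
  cases h with
  | center f z hz =>
    refine ⟨(c.continuous_toCell.comp (c.continuous_pt f)).tendsto z, fun q hq N hN => ?_⟩
    obtain rfl := eq_of_toCell_eq (by rwa [radius_pt f hz.le]) hq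
    refine c.mem_nhds_pt hz.le ?_
    filter_upwards [hN] with u hu _ using hu
  | edge d t ht =>
    refine ⟨c.continuousAt_edgeParam d ht, fun q hq => ?_⟩
    rw [param, edgeParam_ofReal, toCell_eq_side_iff ht] at hq
    rcases hq with hq | hq
    · exact c.map_edgeParam_le d t hq
    · rw [(c.related_edge_opp d (w := t) (by simpa using ht.1) (by simpa using ht.2)).map_nhds_eq]
      have h := c.map_edgeParam_le (opp d) (1 - t) (q := q) (by push_cast; exact hq)
      push_cast at h
      exact h
  | vertex d =>
    refine ⟨c.continuousAt_vertexParam d, fun q hq => ?_⟩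
    rw [param, vertexParam_zero] at hq
    obtain ⟨m, rfl⟩ := exists_turn_pow_of_toCell_eq hq
    rw [(c.related_vertex_turn_pow d m 0).map_nhds_eq, mul_zero]
    exact c.map_vertexParam_le _

theorem map_param_le {i : c.ParamIndex} {z : ℂ} (hz : z ∈ paramDomain i) :
    map (c.param i) (𝓝 z) ≤ 𝓝 (c.param i z) ∧
      ∀ q, c.toCell q = c.param i z → map c.toCell (𝓝 q) ≤ map (c.param i) (𝓝 z) := by
  obtain ⟨j, x, hj, hx⟩ := c.exists_standard hz
  rw [hx.map_nhds_eq, hx.apply_eq]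
  exact hj.map_le

theorem continuousOn_param (i : c.ParamIndex) : ContinuousOn (c.param i) (paramDomain i) :=
  fun _ hz => ContinuousAt.continuousWithinAt (c.map_param_le hz).1

theorem isOpen_param_image (i : c.ParamIndex) (W : Set ℂ) (hW : W ⊆ paramDomain i)
    (hWo : IsOpen W) : IsOpen (c.param i '' W) := by
  rw [isOpen_iff_toCell_preimage, isOpen_iff_mem_nhds]
  rintro q ⟨z, hz, hq⟩
  exact (c.map_param_le (hW hz)).2 q hq.symm (image_mem_map (hWo.mem_nhds hz))

theorem edgeParam_eq_edgeParam_of_im_nonpos {d d' : E × ℤˣ} {w w' : ℂ}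
    (hw : w ∈ paramDomain (.edge (c := c) d)) (hw' : w' ∈ paramDomain (.edge (c := c) d'))
    (him : w.im ≤ 0) (him' : w'.im ≤ 0) (h : c.edgeParam d w = c.edgeParam d' w') :
    (d' = d ∧ w' = w) ∨ (d' = opp d ∧ w' = 1 - w) := by
  obtain ⟨h0, h1⟩ := hw
  obtain ⟨h0', h1'⟩ := hw'
  rw [edgeParam_of_im_nonpos c d him, edgeParam_of_im_nonpos c d' him'] at h
  have hre : |w.re - w'.re| < 1 := by
    rw [abs_lt]
    constructor <;> linarith
  rcases him'.lt_or_eq with him'' | him''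
  · obtain ⟨h1, h2⟩ := eq_and_eq_of_side_eq him him' hre
      (eq_of_toCell_eq (radius_side_lt_one d' him'') h)
    exact Or.inl ⟨h1, h2.symm⟩
  · obtain ⟨t, rfl⟩ : ∃ t : ℝ, w' = t := ⟨w'.re, Complex.ext rfl (by simp [him''])⟩
    rw [toCell_eq_side_iff ⟨by simpa using h0', by simpa using h1'⟩] at h
    rcases h with h | h
    · obtain ⟨h1, h2⟩ := eq_and_eq_of_side_eq him him' hre h
      exact Or.inl ⟨h1, h2.symm⟩
    · have hre' : |w.re - (1 - t : ℂ).re| < 1 := by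
        simp only [Complex.sub_re, Complex.one_re, Complex.ofReal_re] at h0' h1' ⊢
        rw [abs_lt]
        constructor <;> linarith
      obtain ⟨h1, h2⟩ := eq_and_eq_of_side_eq him (by simp) hre' h
      exact Or.inr ⟨by rw [← h1, opp_opp], by rw [h2, sub_sub_cancel]⟩

/-- Replacing `(d, w)` by `(opp d, 1 - w)` achieves a nonpositive imaginary part. -/
theorem exists_edgeParam_eq_of_im_nonpos {d : E × ℤˣ} {w : ℂ}
    (hw : w ∈ paramDomain (.edge (c := c) d)) :
    ∃ e x, x ∈ paramDomain (.edge (c := c) e) ∧ x.im ≤ 0 ∧ c.edgeParam d w = c.edgeParam e x ∧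
      ((d = e ∧ w = x) ∨ (d = opp e ∧ w = 1 - x)) := by
  rcases le_total w.im 0 with h | h
  · exact ⟨d, w, hw, h, rfl, Or.inl ⟨rfl, rfl⟩⟩
  · refine ⟨opp d, 1 - w, ⟨?_, ?_⟩, ?_, (c.edgeParam_opp d hw.1 hw.2).symm,
      Or.inr ⟨(opp_opp d).symm, (sub_sub_cancel 1 w).symm⟩⟩
    · simpa using hw.2
    · simpa using hw.1
    · simpa using h

/-- Two edge parametrizations agree only if they parametrize the same edge. -/
theorem edgeParam_eq_edgeParam {d d' : E × ℤˣ} {w w' : ℂ} (hw : w ∈ paramDomain (.edge (c := c) d))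
    (hw' : w' ∈ paramDomain (.edge (c := c) d')) (h : c.edgeParam d w = c.edgeParam d' w') :
    (d' = d ∧ w' = w) ∨ (d' = opp d ∧ w' = 1 - w) := by
  obtain ⟨e, x, hx, hxi, hex, hde⟩ := c.exists_edgeParam_eq_of_im_nonpos hw
  obtain ⟨e', x', hx', hxi', hex', hde'⟩ := c.exists_edgeParam_eq_of_im_nonpos hw'
  rw [hex, hex'] at h
  have := c.edgeParam_eq_edgeParam_of_im_nonpos hx hx' hxi hxi' h
  clear hx hx' hw hw' hex hex' hxi hxi' h
  rcases hde with ⟨rfl, rfl⟩ | ⟨rfl, rfl⟩ <;> rcases hde' with ⟨rfl, rfl⟩ | ⟨rfl, rfl⟩ <;>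
    rcases this with ⟨rfl, rfl⟩ | ⟨rfl, rfl⟩ <;>
    simp [opp_opp]

/-- Away from its centre, the disk around a vertex is described by half-plane coordinates `w` at one
of the four corners, unique up to the choice of the corner. -/
theorem exists_vertexParam_eq {d : E × ℤˣ} {ζ : ℂ} (hζ : ζ ∈ paramDomain (.vertex (c := c) d))
    (h0 : ζ ≠ 0) :
    ∃ m : ℕ, ∃ u : ℂ, u = Complex.I ^ m * ζ ∧ 0 < u.re ∧ ‖u ^ 2‖ < 1 / 2 ∧
      c.vertexParam d ζ = c.toCell (c.side ((c.turn ^ m) d) (u ^ 2)) ∧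
      ((u ^ 2).im < 0 ∨ ∃ t ∈ Ioo (0 : ℝ) 1, u ^ 2 = t) := by
  obtain ⟨m, hm, hm'⟩ := exists_I_pow_mul_quadrant h0
  have hnorm : ‖(Complex.I ^ m * ζ) ^ 2‖ < 1 / 2 := by
    simpa [paramDomain] using hζ
  refine ⟨m, _, rfl, hm, hnorm, ?_, ?_⟩
  · rw [← c.vertexParam_turn_pow d m, vertexParam, if_pos ⟨hm, hm'⟩]
  · generalize Complex.I ^ m * ζ = u at *
    rcases hm'.lt_or_eq with him | him
    · left
      rw [pow_two, Complex.mul_im]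
      nlinarith
    · right
      obtain ⟨t, rfl⟩ : ∃ t : ℝ, u = t := ⟨u.re, Complex.ext rfl (by simp [him])⟩
      rw [Complex.ofReal_re] at hm
      rw [norm_pow, Complex.norm_real, Real.norm_of_nonneg hm.le] at hnorm
      exact ⟨t ^ 2, ⟨by positivity, by linarith⟩, by push_cast; rfl⟩

omit [Finite E] in
theorem cos_two_pi_mul_ne_one {t : ℝ} (ht : t ∈ Ioo (0 : ℝ) 1) :
    Real.cos (2 * Real.pi * t) ≠ 1 := by
  intro h
  have hpos : 0 < 2 * Real.pi * t := mul_pos Real.two_pi_pos ht.1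
  have hlt : 2 * Real.pi * t < 2 * Real.pi := mul_lt_of_lt_one_right Real.two_pi_pos ht.2
  exact hpos.ne' ((Real.cos_eq_one_iff_of_lt_of_lt (by linarith [Real.two_pi_pos]) hlt).1 h)

theorem powRe_side_zero (d : E × ℤˣ) : powRe (c.side d 0) = 1 := by
  have h := powRe_side_ofReal (c := c) d 0
  rwa [Complex.ofReal_zero, mul_zero, Real.cos_zero] at h

theorem radius_side_zero (d : E × ℤˣ) : radius (c.side d 0) = 1 := by
  have h := radius_side_ofReal (c := c) d 0
  rwa [Complex.ofReal_zero] at h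

/-- Neither an interior point of a polygon nor an interior point of a side is identified with a
corner. -/
theorem toCell_side_ne_vertex {d d' : E × ℤˣ} {w : ℂ}
    (hw : w.im < 0 ∨ ∃ t ∈ Ioo (0 : ℝ) 1, w = t) :
    c.toCell (c.side d w) ≠ c.toCell (c.side d' 0) := by
  intro h
  rcases hw with hw | ⟨t, ht, rfl⟩
  · have h1 := radius_side_lt_one (c := c) d hw
    rw [radius_eq_of_toCell_eq h, radius_side_zero] at h1
    exact lt_irrefl _ h1
  · have h1 : powRe (c.side d t) = powRe (c.side d' 0) := congrArg cellPowRe h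
    rw [powRe_side_ofReal, powRe_side_zero] at h1
    exact cos_two_pi_mul_ne_one ht h1

theorem vertexParam_ne_zero_apply {d d' : E × ℤˣ} {ζ : ℂ}
    (hζ : ζ ∈ paramDomain (.vertex (c := c) d)) (h0 : ζ ≠ 0) :
    c.vertexParam d ζ ≠ c.vertexParam d' 0 := by
  obtain ⟨m, u, -, -, -, h, hu⟩ := c.exists_vertexParam_eq hζ h0
  rw [h, vertexParam_zero]
  exact c.toCell_side_ne_vertex hu

/-- Two vertex parametrizations agree only if they differ by a rotation. -/
theorem vertexParam_eq_vertexParam {d d' : E × ℤˣ} {ζ ζ' : ℂ}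
    (hζ : ζ ∈ paramDomain (.vertex (c := c) d)) (hζ' : ζ' ∈ paramDomain (.vertex (c := c) d'))
    (h : c.vertexParam d ζ = c.vertexParam d' ζ') :
    ∃ m : ℕ, d' = (c.turn ^ m) d ∧ ζ' = Complex.I ^ m * ζ := by
  by_cases h0 : ζ = 0
  · subst h0
    by_cases h0' : ζ' = 0
    · subst h0'
      rw [vertexParam_zero, vertexParam_zero] at h
      obtain ⟨m, hm⟩ := exists_turn_pow_of_toCell_eq h.symm
      exact ⟨m, (eq_and_eq_of_side_eq (by simp) (by simp) (by simp) hm.symm).1, by simp⟩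
    · exact absurd h.symm (c.vertexParam_ne_zero_apply hζ' h0')
  by_cases h0' : ζ' = 0
  · subst h0'
    exact absurd h (c.vertexParam_ne_zero_apply hζ h0)
  obtain ⟨m, u, hu, hre, hnorm, hV, hcase⟩ := c.exists_vertexParam_eq hζ h0
  obtain ⟨m', u', hu', hre', hnorm', hV', hcase'⟩ := c.exists_vertexParam_eq hζ' h0'
  rw [hV, hV'] at h
  have him : (u ^ 2).im ≤ 0 := by
    rcases hcase with h | ⟨t, -, h⟩
    · exact h.le
    · simp [h]
  have hb := abs_lt.1 ((Complex.abs_re_le_norm (u ^ 2)).trans_lt hnorm)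
  have hb' := abs_lt.1 ((Complex.abs_re_le_norm (u' ^ 2)).trans_lt hnorm')
  have hdiff : |(u ^ 2).re - (u' ^ 2).re| < 1 := by
    rw [abs_lt]
    constructor <;> linarith [hb.1, hb.2, hb'.1, hb'.2]
  have key : (c.turn ^ m') d' = (c.turn ^ m) d ∧ u ^ 2 = u' ^ 2 := by
    rcases hcase' with hu' | ⟨t, ht, hu'⟩
    · exact eq_and_eq_of_side_eq him hu'.le hdiff (eq_of_toCell_eq (radius_side_lt_one _ hu') h)
    · rw [hu'] at h hdiff ⊢
      rcases (toCell_eq_side_iff ht).1 h with h | h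
      · exact eq_and_eq_of_side_eq him (by simp) hdiff h
      · obtain ⟨s, hs, hu⟩ := hcase.resolve_left fun hneg => by
          have h1 := radius_side_lt_one (c := c) ((c.turn ^ m) d) hneg
          rw [h, radius_side_one_sub] at h1
          exact lt_irrefl _ h1
        -- both side parameters are less than `1 / 2`, so they do not add up to `1`
        rw [hu', Complex.ofReal_re] at hb'
        rw [hu, Complex.ofReal_re] at hb
        rw [hu] at h
        have hd : |(s : ℂ).re - (1 - t : ℂ).re| < 1 := by
          simp only [Complex.sub_re, Complex.one_re, Complex.ofReal_re]
          rw [abs_lt]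
          constructor <;> linarith [hs.1, hs.2, ht.1, ht.2]
        have h2 := (eq_and_eq_of_side_eq (by simp) (by simp) hd h).2
        have h3 : s = 1 - t := by exact_mod_cast h2
        linarith [hb.2, hb'.2]
  have huu : u' = u := by
    rcases sq_eq_sq_iff_eq_or_eq_neg.1 key.2 with h | h
    · exact h.symm
    · rw [h, Complex.neg_re] at hre
      linarith
  have hI : Complex.I ^ (3 * m') * Complex.I ^ m' = 1 := by
    rw [← pow_add, show 3 * m' + m' = 4 * m' by ring, pow_mul, Complex.I_pow_four, one_pow]
  have ht : (c.turn ^ (3 * m')) ((c.turn ^ m') d') = d' := by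
    rw [← Equiv.Perm.mul_apply, ← pow_add, show 3 * m' + m' = 4 * m' by ring,
      ← turn_pow_mod_four, Nat.mul_mod_right, pow_zero, Equiv.Perm.one_apply]
  refine ⟨3 * m' + m, ?_, ?_⟩
  · rw [pow_add, Equiv.Perm.mul_apply, ← key.1, ht]
  · rw [pow_add, mul_assoc, ← hu, ← huu, hu', ← mul_assoc, hI, one_mul]

theorem injOn_param (i : c.ParamIndex) : InjOn (c.param i) (paramDomain i) := by
  intro z hz w hw h
  cases i with
  | center f =>
    have hz' : ‖z‖ < 1 := hz
    have hw' : ‖w‖ < 1 := hw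
    exact (c.pt_eq_pt hz'.le hw'.le
      (eq_of_toCell_eq (by rwa [radius_pt f hw'.le]) h)).2
  | edge d =>
    rcases c.edgeParam_eq_edgeParam hz hw h with h | h
    · exact h.2.symm
    · exact absurd h.1.symm (opp_ne d)
  | vertex d =>
    obtain ⟨m, hm, rfl⟩ := c.vertexParam_eq_vertexParam hz hw h
    have hm' := c.mod_four_eq_zero_of_turn_pow_eq_self hm.symm
    rw [← Nat.div_add_mod m 4, hm', add_zero, pow_mul, Complex.I_pow_four, one_pow, one_mul]

/-! ### The topology of the cell complex -/

theorem cellRadius_center (f : c.Face) {z : ℂ} (hz : ‖z‖ < 1) :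
    cellRadius (c.param (.center f) z) = ‖z‖ := radius_pt f hz.le

theorem cellRadius_edge (d : E × ℤˣ) (t : ℝ) : cellRadius (c.param (.edge d) t) = 1 := by
  rw [param, edgeParam_ofReal]
  exact radius_side_ofReal d t

theorem cellRadius_vertex (d : E × ℤˣ) : cellRadius (c.param (.vertex d) 0) = 1 := by
  rw [param, vertexParam_zero]
  exact c.radius_side_zero d

omit [Finite E] in
theorem IsStandard.mem_paramDomain {i : c.ParamIndex} {z : ℂ} (h : c.IsStandard i z) :
    z ∈ paramDomain i := by
  cases h with
  | center f z hz => exact hz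
  | edge d t ht => exact ⟨by simpa using ht.1, by simpa using ht.2⟩
  | vertex d => simp [paramDomain]

theorem exists_standard_eq (p : c.CellComplex) : ∃ i z, c.IsStandard i z ∧ c.param i z = p := by
  obtain ⟨q, rfl⟩ := c.toCell_surjective p
  obtain ⟨f, z, hz, rfl⟩ := c.exists_pt_eq q
  rcases hz.lt_or_eq with hz | hz
  · exact ⟨_, _, .center f z hz, rfl⟩
  obtain ⟨d, t, ht, h⟩ := exists_side_of_radius_eq_one ((radius_pt f hz.le).trans hz)
  rcases ht.1.lt_or_eq with h0 | h0
  · exact ⟨_, _, .edge d t ⟨h0, ht.2⟩, by rw [h, param, edgeParam_ofReal]⟩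
  · refine ⟨_, _, .vertex d, ?_⟩
    rw [h, param, vertexParam_zero, ← h0, Complex.ofReal_zero]

/-- Overlapping parametrizations are conformally compatible. -/
theorem related_of_param_eq {i j : c.ParamIndex} {z w : ℂ} (hz : z ∈ paramDomain i)
    (hw : w ∈ paramDomain j) (h : c.param i z = c.param j w) :
    ConformallyRelated c.param i z j w := by
  obtain ⟨i', z', hi, hz'⟩ := c.exists_standard hz
  obtain ⟨j', w', hj, hw'⟩ := c.exists_standard hw
  refine hz'.trans (ConformallyRelated.trans ?_ hw'.symm)
  rw [hz'.apply_eq, hw'.apply_eq] at h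
  clear hz hw hz' hw'
  -- points of different types do not coincide
  cases hi with
  | center f z hz =>
    have hr := c.cellRadius_center f hz
    cases hj with
    | center g w hw =>
      obtain ⟨rfl, rfl⟩ := c.pt_eq_pt hz.le hw.le (eq_of_toCell_eq (by rwa [radius_pt g hw.le]) h)
      exact .refl _ _ _
    | edge d t ht =>
      rw [h, cellRadius_edge] at hr
      exact absurd hr hz.ne'
    | vertex d =>
      rw [h, cellRadius_vertex] at hr
      exact absurd hr hz.ne'
  | edge d t ht =>
    have hm := (IsStandard.edge (c := c) d t ht).mem_paramDomain
    cases hj with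
    | center g w hw =>
      have hr := c.cellRadius_center g hw
      rw [← h, cellRadius_edge] at hr
      exact absurd hr hw.ne'
    | edge d' t' ht' =>
      have hm' := (IsStandard.edge (c := c) d' t' ht').mem_paramDomain
      rcases c.edgeParam_eq_edgeParam hm hm' h with ⟨h1, h2⟩ | ⟨h1, h2⟩
      · rw [h1, h2]
        exact .refl _ _ _
      · rw [h1, h2]
        exact c.related_edge_opp d hm.1 hm.2
    | vertex d' =>
      rw [param, param, edgeParam_ofReal, vertexParam_zero] at h
      exact absurd h (c.toCell_side_ne_vertex (Or.inr ⟨t, ht, rfl⟩))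
  | vertex d =>
    have hm := (IsStandard.vertex (c := c) d).mem_paramDomain
    cases hj with
    | center g w hw =>
      have hr := c.cellRadius_center g hw
      rw [← h, cellRadius_vertex] at hr
      exact absurd hr hw.ne'
    | edge d' t' ht' =>
      rw [param, param, edgeParam_ofReal, vertexParam_zero] at h
      exact absurd h.symm (c.toCell_side_ne_vertex (Or.inr ⟨t', ht', rfl⟩))
    | vertex d' =>
      obtain ⟨m, h1, h2⟩ := c.vertexParam_eq_vertexParam hm
        (IsStandard.vertex (c := c) d').mem_paramDomain h
      subst h1
      simpa using c.related_vertex_turn_pow d m 0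

theorem disjoint_nhds_param {i j : c.ParamIndex} {z w : ℂ} {A B : Set ℂ} (hA : IsOpen A)
    (hB : IsOpen B) (hz : z ∈ A ∩ paramDomain i) (hw : w ∈ B ∩ paramDomain j)
    (h : ∀ a ∈ A ∩ paramDomain i, ∀ b ∈ B ∩ paramDomain j, c.param i a ≠ c.param j b) :
    Disjoint (𝓝 (c.param i z)) (𝓝 (c.param j w)) := by
  have h1 := (c.isOpen_param_image i _ inter_subset_right
    (hA.inter (c.isOpen_paramDomain i))).mem_nhds (mem_image_of_mem (c.param i) hz)
  have h2 := (c.isOpen_param_image j _ inter_subset_right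
    (hB.inter (c.isOpen_paramDomain j))).mem_nhds (mem_image_of_mem (c.param j) hw)
  refine Filter.disjoint_of_disjoint_of_mem ?_ h1 h2
  rw [Set.disjoint_left]
  rintro _ ⟨a, ha, rfl⟩ ⟨b, hb, hab⟩
  exact h a ha b hb hab.symm

theorem disjoint_nhds_of_mem {i : c.ParamIndex} {z w : ℂ} (hz : z ∈ paramDomain i)
    (hw : w ∈ paramDomain i) (h : c.param i z ≠ c.param i w) :
    Disjoint (𝓝 (c.param i z)) (𝓝 (c.param i w)) := by
  obtain ⟨A, B, hA, hB, hzA, hwB, hAB⟩ := t2_separation fun H : z = w => h (congrArg _ H)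
  refine c.disjoint_nhds_param hA hB ⟨hzA, hz⟩ ⟨hwB, hw⟩ fun a ha b hb hab => ?_
  rw [c.injOn_param i ha.2 hb.2 hab] at ha
  exact Set.disjoint_left.1 hAB ha.1 hb.1

theorem disjoint_nhds_of_range {i j : c.ParamIndex} {z w : ℂ} (hz : z ∈ paramDomain i)
    (hw : w ∈ paramDomain j)
    (h : ∀ a ∈ paramDomain i, ∀ b ∈ paramDomain j, c.param i a ≠ c.param j b) :
    Disjoint (𝓝 (c.param i z)) (𝓝 (c.param j w)) :=
  c.disjoint_nhds_param isOpen_univ isOpen_univ ⟨mem_univ _, hz⟩ ⟨mem_univ _, hw⟩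
    fun a ha b hb => h a ha.2 b hb.2

omit [Finite E] in
theorem disjoint_nhds_of_apply_ne {X Y : Type*} [TopologicalSpace X] [TopologicalSpace Y]
    [T2Space Y] {f : X → Y} (hf : Continuous f) {p q : X} (h : f p ≠ f q) :
    Disjoint (𝓝 p) (𝓝 q) :=
  (hf.tendsto p).disjoint (disjoint_nhds_nhds.2 h) (hf.tendsto q)

instance t2Space_cellComplex : T2Space c.CellComplex := by
  rw [t2Space_iff_disjoint_nhds]
  intro p q hpq
  obtain ⟨i, z, hi, rfl⟩ := c.exists_standard_eq p
  obtain ⟨j, w, hj, rfl⟩ := c.exists_standard_eq q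
  -- points of different types are separated by `cellRadius` or `cellPowRe`
  by_cases hR : cellRadius (c.param i z) = cellRadius (c.param j w)
  swap
  · exact disjoint_nhds_of_apply_ne continuous_cellRadius hR
  by_cases hP : cellPowRe (c.param i z) = cellPowRe (c.param j w)
  swap
  · exact disjoint_nhds_of_apply_ne continuous_cellPowRe hP
  have hm := hi.mem_paramDomain
  have hm' := hj.mem_paramDomain
  cases hi with
  | center f z hz =>
    rw [cellRadius_center c f hz] at hR
    cases hj with
    | center g w hw =>
      by_cases hfg : f = g
      · subst hfg
        exact c.disjoint_nhds_of_mem hm hm' hpq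
      · refine c.disjoint_nhds_of_range hm hm' fun a ha b hb hab => hfg ?_
        have ha' : ‖a‖ < 1 := ha
        have hb' : ‖b‖ < 1 := hb
        exact (c.pt_eq_pt ha'.le hb'.le (eq_of_toCell_eq (by rwa [radius_pt g hb'.le]) hab)).1
    | edge d t ht => exact absurd (hR.trans (c.cellRadius_edge d t)) hz.ne
    | vertex d => exact absurd (hR.trans (c.cellRadius_vertex d)) hz.ne
  | edge d t ht =>
    rw [cellRadius_edge] at hR
    rw [param, edgeParam_ofReal, cellPowRe_toCell, powRe_side_ofReal] at hP
    cases hj with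
    | center g w hw => exact absurd (hR.trans (c.cellRadius_center g hw)).symm hw.ne
    | edge d' t' ht' =>
      by_cases hd : d' = d
      · subst hd
        exact c.disjoint_nhds_of_mem hm hm' hpq
      by_cases hd' : d' = opp d
      · subst hd'
        have h := (c.related_edge_opp (opp d) hm'.1 hm'.2).apply_eq
        rw [opp_opp] at h
        rw [h] at hpq ⊢
        exact c.disjoint_nhds_of_mem hm ⟨by simpa using hm'.2, by simpa using hm'.1⟩ hpq
      · refine c.disjoint_nhds_of_range hm hm' fun a ha b hb hab => ?_
        rcases c.edgeParam_eq_edgeParam ha hb hab with h | h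
        · exact hd h.1
        · exact hd' h.1
    | vertex d' =>
      rw [param, vertexParam_zero, cellPowRe_toCell, powRe_side_zero] at hP
      exact absurd hP (cos_two_pi_mul_ne_one ht)
  | vertex d =>
    rw [cellRadius_vertex] at hR
    rw [param, vertexParam_zero, cellPowRe_toCell, powRe_side_zero] at hP
    cases hj with
    | center g w hw => exact absurd (hR.trans (c.cellRadius_center g hw)).symm hw.ne
    | edge d' t' ht' =>
      rw [param, edgeParam_ofReal, cellPowRe_toCell, powRe_side_ofReal] at hP
      exact absurd hP.symm (cos_two_pi_mul_ne_one ht')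
    | vertex d' =>
      refine c.disjoint_nhds_of_range hm hm' fun a ha b hb hab => hpq ?_
      obtain ⟨m, rfl, -⟩ := c.vertexParam_eq_vertexParam ha hb hab
      rw [(c.related_vertex_turn_pow d m 0).apply_eq, mul_zero]

instance compactSpace_cellComplex : CompactSpace c.CellComplex := by
  have : Finite c.Face := inferInstanceAs (Finite (Quotient _))
  have : CompactSpace c.Polygons :=
    inferInstanceAs (CompactSpace ((_ : c.Face) × Metric.closedBall (0 : ℂ) 1))
  exact inferInstanceAs (CompactSpace (Quot c.Glue))

theorem connectedSpace_cellComplex (hconn : G.Connected) : ConnectedSpace c.CellComplex := by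
  have : PreconnectedSpace c.CellComplex := by
    refine preconnectedSpace_of_forall_constant fun F hF => ?_
    -- a locally constant function is constant on each polygon
    have hface : ∀ f z, F (c.toCell (c.pt f z)) = F (c.toCell (c.pt f 0)) := fun f z =>
      PreconnectedSpace.constant inferInstance
        (hF.comp (c.continuous_toCell.comp (c.continuous_pt f)))
    let val : E × ℤˣ → Bool := fun d => F (c.toCell (c.pt (c.face d) 0))
    have hside : ∀ d w, F (c.toCell (c.side d w)) = val d := fun d w => hface _ _
    have hopp : ∀ d, val (opp d) = val d := by
      intro d
      have h := c.toCell_side_opp d (t := 0) (by simp)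
      rw [← hside (opp d) (1 - (0 : ℝ)), ← h, hside]
    have hrot : ∀ d, val (c.rot d) = val d := by
      intro d
      rw [← opp_succ, hopp]
      exact congrArg (fun f => F (c.toCell (c.pt f 0))) (c.face_succ d)
    have hrotpow : ∀ d (m : ℕ), val ((c.rot ^ m) d) = val d := by
      intro d m
      induction m with
      | zero => rfl
      | succ m ih => rw [pow_succ', Equiv.Perm.mul_apply, hrot, ih]
    have hinc : ∀ d d', G.inc d = G.inc d' → val d = val d' := by
      intro d d' h
      obtain ⟨m, rfl⟩ := c.exists_rot_pow_eq h
      exact (hrotpow d m).symm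
    have hedge : ∀ e : E, val (e, -1) = val (e, 1) := fun e => hopp (e, 1)
    have hwalk : ∀ d d', val d = val d' := by
      intro d d'
      obtain ⟨p⟩ := hconn.preconnected (G.inc d) (G.inc d')
      generalize hv : G.inc d = v at p
      generalize hw : G.inc d' = w at p
      induction p generalizing d with
      | nil => exact hinc _ _ (hv.trans hw.symm)
      | cons hadj p ih =>
        rw [SimpleGraph.fromRel_adj] at hadj
        obtain ⟨-, ⟨e, h1, h2⟩ | ⟨e, h1, h2⟩⟩ := hadj
        · rw [hinc d (e, -1) (hv.trans h1.symm), hedge, ih (e, 1) h2 hw]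
        · rw [hinc d (e, 1) (hv.trans h2.symm), ← hedge, ih (e, -1) h1 hw]
    intro p q
    obtain ⟨a, rfl⟩ := c.toCell_surjective p
    obtain ⟨b, rfl⟩ := c.toCell_surjective q
    obtain ⟨f, z, -, rfl⟩ := c.exists_pt_eq a
    obtain ⟨g, w, -, rfl⟩ := c.exists_pt_eq b
    rw [hface f, hface g, ← c.face_base f, ← c.face_base g]
    exact hwalk (c.base f) (c.base g)
  obtain ⟨v⟩ := hconn.nonempty
  exact { toNonempty := ⟨c.toCell (c.pt (c.face (c.order v 0)) 0)⟩ }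

end CyclicOrdering

end OrientedMultigraph

theorem mainTheorem3 {V : Type*} {E : Type u} [Finite V] [Finite E]
    (G : OrientedMultigraph V E) (hconn : G.Connected) (hreg : G.IsRegularOfDegree 4)
    (c : G.CyclicOrdering) :
    ∃ (S : Type u) (_ : TopologicalSpace S) (_ : ChartedSpace (EuclideanSpace ℝ (Fin 2)) S),
      IsManifold (𝓡 2) ∞ S ∧ T2Space S ∧ SecondCountableTopology S ∧
      CompactSpace S ∧ ConnectedSpace S ∧ IsOrientableSurface S ∧
      Nonempty (c.CellComplex ≃ₜ S) := by
  obtain ⟨C, hman, hor⟩ := exists_orientable_surface_of_conformallyRelated c.param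
    OrientedMultigraph.CyclicOrdering.paramDomain c.isOpen_paramDomain c.continuousOn_param
    c.injOn_param c.isOpen_param_image
    (fun p => by
      obtain ⟨i, z, hi, h⟩ := c.exists_standard_eq p
      exact ⟨i, z, hi.mem_paramDomain, h⟩)
    fun i j z hz w hw h => c.related_of_param_eq hz hw h
  exact ⟨c.CellComplex, inferInstance, C, hman, inferInstance,
    ChartedSpace.secondCountable_of_sigmaCompact (EuclideanSpace ℝ (Fin 2)) c.CellComplex,
    inferInstance, c.connectedSpace_cellComplex hconn, hor, ⟨Homeomorph.refl _⟩⟩
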